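/- **Setting (domain and mesh).** Let $\Omega\subset\mathbb R^2$ be a bounded, connected open set with Lebesgue-null boundary, let $\Gamma_{Dir}\subset\partial\Omega$, and let $\mathcal T$ be a finite conforming triangulation of $\overline\Omega$ (nondegenerate closed triangles with union $\overline\Omega$, any two of which meet in the empty set, a common vertex or a common edge) with vertex set $\mathcal V$, points $x_K$ ($K\in\mathcal V$). Let $\mathcal V_{Dir}=\{K: x_K\in\Gamma_{Dir}\}$, assumed non-empty, and $\mathcal V_{Dir}^c=\mathcal V\setminus\mathcal V_{Dir}$. For a triangle $T$ with vertex $K$, $\mathcal V_{KT}$ is the set of the other two vertices of $T$, and $A_K^T$ is the quadrilateral with vertices $x_K$, the barycenter of $T$ and the midpoints of the two edges of $T$ at $x_K$; $\mathcal T_K$ is the set of triangles with vertex $K$, $A_K=\bigcup_{T\in\mathcal T_K}A_K^T$, and $m_{A_K}=|A_K|$. Let $V_{\mathcal T}\cong\mathbb R^{\mathcal V}$ be the space of continuous functions that are affine on each triangle, $(\varphi_K)$ its nodal basis, $V_{\mathcal T}^0$ the subspace of functions vanishing at the vertices in $\mathcal V_{Dir}$, $\|f\|_{V_{\mathcal T}}^2=\int_\Omega|\nabla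 f|^2dx$, and $\delta_{KL}f=f_L-f_K$. **Data.** There are two phases $\alpha\in\{g,w\}$, $|g|=0$, $|w|=1$. The capillary pressure $p_c:\mathbb R\to\mathbb R$ is an increasing homeomorphism, piecewise $C^1$ with bounded derivative, $p_c(0)=0$. The mobilities $M_\alpha:\mathbb R\to\mathbb R$ are continuous, nondecreasing on $[0,1]$, $M_\alpha(s)=0$ for $s\le0$, $M_\alpha(s)=M_\alpha(1)$ for $s\ge1$, and $M(s):=M_w(1-s)+M_g(s)\ge m_0>0$ for $s\in[0,1]$. The densities $\rho_\alpha\in C^1(\mathbb R)$ are nondecreasing with $0<\rho_0\le\rho_\alpha\le\rho_1$. The porosity $\phi$ is measurable with $0<\phi_0\le\phi\le\phi_1$ a.e. in $\Omega$; the permeability $\Lambda$ is a measurable field of symmetric $2\times2$ matrices with $\underline\Lambda|v|^2\le\Lambda(x)v\cdot v\le\overline\Lambda|v|^2$ for all $v$ and a.e. $x\in\Omega$, with $\underline\Lambda>0$. Put $\phi_K=m_{A_K}^{-1}\int_{A_K}\phi$, $\Lambda_{KL}^T=-\int_T\Lambda\nabla\varphi_K\cdot\nabla\varphi_L\,dx$,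 $\mathcal V_{KT}^+=\{L\in\mathcal V_{KT}:\Lambda_{KL}^T\ge0\}$, $M_\alpha^\epsilon=\epsilon+M_\alpha$, $\mathcal Z(s)=\min(1,\max(0,s))$. **Scheme.** For $p=(p_g,p_w)\in V_{\mathcal T}^0\times V_{\mathcal T}^0$ let $s_{g,K}=p_c^{-1}(p_{g,K}-p_{w,K})$, $s_{w,K}=1-s_{g,K}$ for $K\in\mathcal V$. Let $\rho_{\alpha,KL}$ be given by $\frac1{\rho_{\alpha,KL}}=\frac1{p_{\alpha,L}-p_{\alpha,K}}\int_{p_{\alpha,K}}^{p_{\alpha,L}}\frac{dz}{\rho_\alpha(z)}$ if $p_{\alpha,K}\ne p_{\alpha,L}$ and $\rho_{\alpha,KL}=\rho_\alpha(p_{\alpha,K})$ otherwise. In a triangle $T$ let $s_{\alpha,KL}=s_{\alpha,L}$ if $\Lambda_{KL}^T\ge0$ and $\delta_{KL}p_\alpha\ge0$, $s_{\alpha,KL}=s_{\alpha,K}$ if $\Lambda_{KL}^T\ge0$ and $\delta_{KL}p_\alpha<0$, and $s_{\alpha,KL}=\min_{J\text{ vertex of }T}s_{\alpha,J}$ if $\Lambda_{KL}^T<0$.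 Fix $\delta t>0$ and $p^n\in V_{\mathcal T}^0\times V_{\mathcal T}^0$ whose saturations satisfy $0\le s^n_{\alpha,K}\le1$ for all $\alpha$ and $K$. For $\epsilon,\eta\ge0$, $\alpha\in\{g,w\}$, $K\in\mathcal V_{Dir}^c$ define $$\begin{aligned}\mathcal F^{\epsilon,\eta}_{\alpha,K}(p)={}&m_{A_K}\phi_K\big(\rho_\alpha(p_{\alpha,K})\mathcal Z(s_{\alpha,K})-\rho_\alpha(p^n_{\alpha,K})s^n_{\alpha,K}\big)-\delta t\sum_{T\in\mathcal T_K}\sum_{L\in\mathcal V_{KT}}\rho_{\alpha,KL}M_\alpha^\epsilon(s_{\alpha,KL})\Lambda_{KL}^T\,\delta_{KL}p_\alpha\\&-\delta t\,\eta(-1)^{|\alpha|}\sum_{T\in\mathcal T_K}\sum_{L\in\mathcal V_{KT}^+}\rho_{\alpha,KL}|\Lambda_{KL}^T|\big(p_c(s_{g,L})-p_c(s_{g,K})\big).\end{aligned}$$ The original CVFE scheme $\mathcal F(p)=0$ is given by the same formula with $M_\alpha$ in place of $M_\alpha^\epsilon$ and without the last sum; its unknown is $p\in V_{\mathcal T}^0\times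 V_{\mathcal T}^0$. The discrete global pressure is $\zeta_K=p_{g,K}-\int_0^{s_{g,K}}\frac{M_w(1-u)}{M(u)}p_c'(u)\,du=p_{w,K}+\int_0^{s_{g,K}}\frac{M_g(u)}{M(u)}p_c'(u)\,du$. Put $\zeta_g=\zeta_w=\zeta$. **Theorem.** (1) $\mathcal F^{\epsilon,\eta}$ is a regularized scheme of $\mathcal F$, that is: * (P.a) $(\epsilon,\eta,p)\mapsto\mathcal F^{\epsilon,\eta}(p)$ is continuous on $[0,\infty)^2\times(V_{\mathcal T}^0)^2$; * (P.b) $\mathcal F^{0,0}=\mathcal F$; * (P.c) for every $\eta>0$, every solution $p$ of $\mathcal F^{0,\eta}(p)=0$ satisfies $0\le s_{\alpha,K}\le1$ for all $\alpha$ and all $K\in\mathcal V$; * (P.d) for every $\eta>0$ there is $C_\eta$ such that for every $\epsilon>0$ and every solution $p$ of $\mathcal F^{\epsilon,\eta}(p)=0$, $$\sum_{\alpha}\|\zeta_\alpha\|_{V_{\mathcal T}}^2+\epsilon\sum_\alpha\|p_\alpha\|_{V_{\mathcal T}}^2+\eta\sum_{\alpha}\|p_{\sigma_1(\alpha)}-p_{\sigma_2(\alpha)}\|_{V_{\mathcal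 T}}^2\le C_\eta,$$ where $\sigma_1,\sigma_2$ are any permutations of $\{g,w\}$ with $\sigma_1(\alpha)\ne\sigma_2(\alpha)$ for all $\alpha$ (so that the last sum is $2\|p_g-p_w\|_{V_{\mathcal T}}^2$); * (P.e) there is $C$ such that for every $\eta>0$ and every solution $p$ of $\mathcal F^{0,\eta}(p)=0$, $\sum_\alpha\|\zeta_\alpha\|_{V_{\mathcal T}}^2\le C$. (2) For all $\epsilon,\eta>0$ the regularized scheme $\mathcal F^{\epsilon,\eta}(p)=0$ has a solution $p\in V_{\mathcal T}^0\times V_{\mathcal T}^0$. (3) The original CVFE scheme $\mathcal F(p)=0$ has a solution $p\in V_{\mathcal T}^0\times V_{\mathcal T}^0$, and this solution can be chosen such that $0\le s_{\alpha,K}\le1$ for all $\alpha$ and all $K\in\mathcal V$. -/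

import Mathlib

open Set MeasureTheory

namespace CVFE

/-- The Euclidean plane. -/
abbrev Plane := EuclideanSpace ℝ (Fin 2)

/-! ### Conforming triangular meshes -/

/-- A conforming triangulation of (the closure of) a plane domain `Ω`. The vertices are labelled by
the finite type `V`; a cell is the set of labels of its three vertices. -/
structure TriMesh (V : Type*) [DecidableEq V] (Ω : Set Plane) where
  /-- position `x_K` of the vertex `K` -/
  pos : V → Plane
  pos_injective : Function.Injective pos
  /-- the triangles -/
  cells : Finset (Finset V)
  card_cell : ∀ T ∈ cells, T.card = 3
  /-- triangles are nondegenerate -/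
  affineIndependent_cell : ∀ T ∈ cells, AffineIndependent ℝ (fun K : T => pos K)
  /-- two triangles meet in the convex hull of their common vertices:
  the empty set, a common vertex, or a common edge -/
  conforming : ∀ T ∈ cells, ∀ T' ∈ cells,
    convexHull ℝ (pos '' (T : Set V)) ∩ convexHull ℝ (pos '' (T' : Set V)) ⊆
      convexHull ℝ (pos '' ((T ∩ T' : Finset V) : Set V))
  /-- the closed triangles cover the closure of the domain, and nothing else -/
  cover : ⋃ T ∈ cells, convexHull ℝ (pos '' (T : Set V)) = closure Ω
  /-- every label is a vertex of some triangle -/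
  exists_cell : ∀ K : V, ∃ T ∈ cells, K ∈ T

namespace TriMesh

variable {V : Type*} [DecidableEq V] {Ω : Set Plane} (M : TriMesh V Ω)

theorem cell_nonempty (T : M.cells) : T.1.Nonempty := by
  rw [← Finset.card_pos, M.card_cell T.1 T.2]
  norm_num

/-- The three vertices of a triangle form an affine basis of the plane. -/
noncomputable def basis (T : M.cells) : AffineBasis T.1 ℝ Plane where
  toFun K := M.pos K
  ind' := M.affineIndependent_cell T.1 T.2
  tot' := by
    rw [(M.affineIndependent_cell T.1 T.2).affineSpan_eq_top_iff_card_eq_finrank_add_one]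
    simp [M.card_cell T.1 T.2]

/-- The closed triangle `T`. -/
def triangle (T : M.cells) : Set Plane := convexHull ℝ (M.pos '' (T.1 : Set V))

/-- The affine function which coincides on the triangle `T` with the `ℙ₁` shape function `φ_K`:
the barycentric coordinate of `x_K` if `K` is a vertex of `T`, and zero otherwise. -/
noncomputable def shape (T : M.cells) (K : V) : Plane →ᵃ[ℝ] ℝ :=
  if h : K ∈ T.1 then (M.basis T).coord ⟨K, h⟩ else 0

/-- The gradient of the shape function `φ_K` at the point `x` of the triangle `T`. -/
noncomputable def shapeGrad (T : M.cells) (K : V) (x : Plane) : Plane :=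
  gradient (fun y => M.shape T K y) x

/-- The part `A_K^T` of the control volume of `K` in a triangle `T` with vertex `K`: the (convex)
quadrilateral whose vertices are `x_K`, the barycenter of `T`, and the midpoints of the two edges of
`T` at `x_K`. -/
def subcell (T : M.cells) (K : V) : Set Plane :=
  convexHull ℝ ({M.pos K, T.1.centroid ℝ M.pos} ∪
    (fun L => midpoint ℝ (M.pos K) (M.pos L)) '' (T.1.erase K : Set V))

/-- The control volume `A_K`. -/
def controlVolume (K : V) : Set Plane := ⋃ T : M.cells, ⋃ _ : K ∈ T.1, M.subcell T K

/-- The measure `m_{A_K}` of the control volume. -/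
noncomputable def cvMeasure (K : V) : ℝ := volume.real (M.controlVolume K)

/-- The natural seminorm `‖f‖_{V_𝒯} = (∫_Ω ‖∇f‖²)^{1/2}` of the continuous piecewise affine function
`f = ∑ f_K φ_K` with nodal values `f_K`, the integral being computed triangle by triangle. -/
noncomputable def gradNorm [Fintype V] (f : V → ℝ) : ℝ :=
  √(∑ T : M.cells, ∫ x in M.triangle T, ‖∑ K, f K • M.shapeGrad T K x‖ ^ 2)

/-- The space `V_𝒯⁰` of discrete functions, given by their nodal values, which vanish at the vertices
located on the Dirichlet boundary `ΓD`. -/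
def dirichletSpace (ΓD : Set Plane) : Submodule ℝ (V → ℝ) where
  carrier := {f | ∀ K, M.pos K ∈ ΓD → f K = 0}
  add_mem' := fun {f g} hf hg K hK => by simp [hf K hK, hg K hK]
  zero_mem' := fun _ _ => rfl
  smul_mem' := fun c f hf K hK => by simp [hf K hK]

/-- Pairs of discrete phase pressures in `V_𝒯⁰`; the index `0` is the gas phase and the index `1` is
the wetting phase. -/
abbrev Pressures (ΓD : Set Plane) := Fin 2 → M.dirichletSpace ΓD

/-- The labels of the vertices which are not located on the Dirichlet boundary. -/
abbrev FreeVertex (ΓD : Set Plane) := {K : V // M.pos K ∉ ΓD}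

end TriMesh

/-! ### The two-phase flow model -/

/-- The data of the compressible two-phase Darcy model on `Ω` with the assumptions on them.
The phase `0` is the gas, the phase `1` is the wetting phase. -/
structure TwoPhaseModel (Ω : Set Plane) where
  /-- capillary pressure, as a function of the gas saturation -/
  pc : ℝ ≃ₜ ℝ
  pc_strictMono : StrictMono pc
  pc_zero : pc 0 = 0
  /-- `pc` is piecewise `C¹` (with a locally finite set `S` of break points), with bounded
  derivative -/
  pc_piecewise : ∃ S : Set ℝ, (∀ a b : ℝ, (S ∩ Icc a b).Finite) ∧ ContDiffOn ℝ 1 pc Sᶜ ∧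
    ∃ L : ℝ, ∀ u ∈ Sᶜ, |deriv pc u| ≤ L
  /-- mobility of each phase, as a function of the saturation of this phase -/
  mob : Fin 2 → ℝ → ℝ
  mob_continuous : ∀ α, Continuous (mob α)
  mob_monotone : ∀ α, MonotoneOn (mob α) (Icc 0 1)
  mob_of_nonpos : ∀ α, ∀ s ≤ 0, mob α s = 0
  mob_of_one_le : ∀ α, ∀ s, 1 ≤ s → mob α s = mob α 1
  /-- lower bound of the total mobility -/
  m₀ : ℝ
  m₀_pos : 0 < m₀
  le_total_mob : ∀ s ∈ Icc (0 : ℝ) 1, m₀ ≤ mob 1 (1 - s) + mob 0 s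
  /-- density of each phase, as a function of the pressure of this phase -/
  ρ : Fin 2 → ℝ → ℝ
  ρ_contDiff : ∀ α, ContDiff ℝ 1 (ρ α)
  ρ_monotone : ∀ α, Monotone (ρ α)
  ρ₀ : ℝ
  ρ₁ : ℝ
  ρ₀_pos : 0 < ρ₀
  ρ_bounds : ∀ α z, ρ₀ ≤ ρ α z ∧ ρ α z ≤ ρ₁
  /-- porosity -/
  φ : Plane → ℝ
  φ_measurable : AEStronglyMeasurable φ (volume.restrict Ω)
  φ₀ : ℝ
  φ₁ : ℝ
  φ₀_pos : 0 < φ₀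
  φ_bounds : ∀ᵐ x ∂volume.restrict Ω, φ₀ ≤ φ x ∧ φ x ≤ φ₁
  /-- permeability tensor -/
  Λ : Plane → Plane →L[ℝ] Plane
  Λ_measurable : AEStronglyMeasurable Λ (volume.restrict Ω)
  Λ_symm : ∀ᵐ x ∂volume.restrict Ω, ∀ v w, inner ℝ (Λ x v) w = inner ℝ v (Λ x w)
  Λ₀ : ℝ
  Λ₁ : ℝ
  Λ₀_pos : 0 < Λ₀
  Λ_bounds : ∀ᵐ x ∂volume.restrict Ω, ∀ v,
    Λ₀ * ‖v‖ ^ 2 ≤ inner ℝ (Λ x v) v ∧ inner ℝ (Λ x v) v ≤ Λ₁ * ‖v‖ ^ 2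

namespace TwoPhaseModel

variable {Ω : Set Plane} (D : TwoPhaseModel Ω)

/-- The saturations `(s_g, s_w) = (pc⁻¹(p_g - p_w), 1 - pc⁻¹(p_g - p_w))`. -/
noncomputable def G (pg pw : ℝ) : Fin 2 → ℝ :=
  ![D.pc.symm (pg - pw), 1 - D.pc.symm (pg - pw)]

/-- The regularized mobility `ε + M_α(s)`. -/
def mobReg (ε : ℝ) (α : Fin 2) (s : ℝ) : ℝ := ε + D.mob α s

/-- The total mobility, as a function of the gas saturation. -/
def totalMob (s : ℝ) : ℝ := D.mob 1 (1 - s) + D.mob 0 s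

/-- The corrective pressure of the gas phase. -/
noncomputable def pHatG (s : ℝ) : ℝ :=
  ∫ u in (0 : ℝ)..s, D.mob 1 (1 - u) / D.totalMob u * deriv D.pc u

/-- The corrective pressure of the wetting phase. -/
noncomputable def pHatW (s : ℝ) : ℝ :=
  ∫ u in (0 : ℝ)..s, D.mob 0 u / D.totalMob u * deriv D.pc u

/-- The mean density between the pressures `a` and `b` of the phase `α`. -/
noncomputable def meanDensity (α : Fin 2) (a b : ℝ) : ℝ :=
  if a = b then D.ρ α a else (1 / (b - a) * ∫ z in a..b, 1 / D.ρ α z)⁻¹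

end TwoPhaseModel

/-- The truncation of the saturation to `[0, 1]`. -/
noncomputable def trunc (s : ℝ) : ℝ := if s < 0 then 0 else if s ≤ 1 then s else 1

/-! ### The CVFE scheme and its regularization -/

section Scheme

variable {V : Type*} [DecidableEq V] {Ω : Set Plane} (M : TriMesh V Ω) (D : TwoPhaseModel Ω)

/-- The stiffness coefficient `Λ_{KL}^T = -∫_T Λ ∇φ_K · ∇φ_L`. -/
noncomputable def stiffness (T : M.cells) (K L : V) : ℝ :=
  -∫ x in M.triangle T, inner ℝ (D.Λ x (M.shapeGrad T K x)) (M.shapeGrad T L x)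

/-- The mean value of the porosity on the control volume. -/
noncomputable def meanPorosity (K : V) : ℝ :=
  1 / M.cvMeasure K * ∫ x in M.controlVolume K, D.φ x

variable {M} {ΓD : Set Plane}

/-- The saturation of the phase `α` at the vertex `K`. -/
noncomputable def sat (p : M.Pressures ΓD) (α : Fin 2) (K : V) : ℝ :=
  D.G ((p 0).1 K) ((p 1).1 K) α

/-- The non-physical quantities `p_g - p̂_g(s_g)` and `p_w + p̂_w(s_g)` at the vertices; both are the
discrete global pressure. -/
noncomputable def zeta (p : M.Pressures ΓD) (i : Fin 2) (K : V) : ℝ :=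
  ![(p 0).1 K - D.pHatG (sat D p 0 K), (p 1).1 K + D.pHatW (sat D p 0 K)] i

/-- The saturation `s_{α,KL}` at the interface between `K` and `L` in the triangle `T`: upwind if the
stiffness coefficient is nonnegative, smallest value on the triangle otherwise. -/
noncomputable def interfaceSat (p : M.Pressures ΓD) (α : Fin 2) (T : M.cells) (K L : V) : ℝ :=
  if 0 ≤ stiffness M D T K L then
    if 0 ≤ (p α).1 L - (p α).1 K then sat D p α L else sat D p α K
  else T.1.inf' (M.cell_nonempty T) (sat D p α)

/-- The accumulation term at the vertex `K`, from the old pressures `pn` to the pressures `p`. -/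
noncomputable def accumulation (pn p : M.Pressures ΓD) (α : Fin 2) (K : V) : ℝ :=
  M.cvMeasure K * meanPorosity M D K *
    (D.ρ α ((p α).1 K) * trunc (sat D p α K) - D.ρ α ((pn α).1 K) * sat D pn α K)

/-- The CVFE scheme: the equations `scheme D δt pn p = 0` for the unknown `p`, one for each phase and
each vertex off the Dirichlet boundary. -/
noncomputable def scheme (δt : ℝ) (pn p : M.Pressures ΓD) (α : Fin 2) (K : M.FreeVertex ΓD) : ℝ :=
  accumulation D pn p α K
    - δt * ∑ T : M.cells with K.1 ∈ T.1, ∑ L ∈ T.1.erase K.1,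
        D.meanDensity α ((p α).1 K) ((p α).1 L) * D.mob α (interfaceSat D p α T K L) *
          stiffness M D T K L * ((p α).1 L - (p α).1 K)

/-- The `(ε, η)`-regularized CVFE scheme. -/
noncomputable def schemeReg (δt : ℝ) (pn : M.Pressures ΓD) (ε η : ℝ) (p : M.Pressures ΓD)
    (α : Fin 2) (K : M.FreeVertex ΓD) : ℝ :=
  accumulation D pn p α K
    - δt * ∑ T : M.cells with K.1 ∈ T.1, ∑ L ∈ T.1.erase K.1,
        D.meanDensity α ((p α).1 K) ((p α).1 L) * D.mobReg ε α (interfaceSat D p α T K L) *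
          stiffness M D T K L * ((p α).1 L - (p α).1 K)
    - δt * η * (-1) ^ (α : ℕ) *
      ∑ T : M.cells with K.1 ∈ T.1, ∑ L ∈ T.1.erase K.1 with 0 ≤ stiffness M D T K L,
        D.meanDensity α ((p α).1 K) ((p α).1 L) * |stiffness M D T K L| *
          (D.pc (sat D p 0 L) - D.pc (sat D p 0 K))

end Scheme

/-! ### Regularized schemes -/

/-- `Freg` is a regularized scheme of the scheme `F`. The unknowns are `l` discrete functions with
nodes `A` in the space `W`, `u` are the saturations, with physical range `[umin, umax]`, `ζ` are the
non-physical quantities, and `N` is the discrete norm; `Pa`, …, `Pe` are the five properties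
required in the definition. -/
structure IsRegularizedScheme {l : ℕ} {A B : Type*} (W : Submodule ℝ (A → ℝ))
    (N : (A → ℝ) → ℝ) (u ζ : (Fin l → W) → Fin l → A → ℝ) (umin umax : ℝ)
    (σ₁ σ₂ : Equiv.Perm (Fin l)) (F : (Fin l → W) → Fin l → B → ℝ)
    (Freg : ℝ → ℝ → (Fin l → W) → Fin l → B → ℝ) : Prop where
  /-- continuity in the parameters, jointly with the unknown -/
  Pa : ContinuousOn (fun q : ℝ × ℝ × (Fin l → W) => Freg q.1 q.2.1 q.2.2)
    {q | 0 ≤ q.1 ∧ 0 ≤ q.2.1}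
  /-- consistency -/
  Pb : Freg 0 0 = F
  /-- maximum principle for `ε = 0`, `η > 0` -/
  Pc : ∀ η > 0, ∀ p, Freg 0 η p = 0 → ∀ i a, umin ≤ u p i a ∧ u p i a ≤ umax
  /-- energy estimate, uniform in `ε` -/
  Pd : ∀ η > 0, ∃ C : ℝ, ∀ ε > 0, ∀ p, Freg ε η p = 0 →
    ∑ i, N (ζ p i) ^ 2 + ε * ∑ i, N (p i) ^ 2 + η * ∑ i, N (p (σ₁ i) - p (σ₂ i) : W) ^ 2 ≤ C
  /-- energy estimate for `ε = 0`, uniform in `η` -/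
  Pe : ∃ C : ℝ, ∀ η > 0, ∀ p, Freg 0 η p = 0 → ∑ i, N (ζ p i) ^ 2 ≤ C

end CVFE

/-! The whole proof rests on one energy estimate, obtained by testing the phase equations with
`potential`, the primitive of `1 / ρ_α`. The mean density is chosen so that its product with a
potential difference is the pressure difference. Densities therefore drop out of the fluxes, and
discrete integration by parts leaves quadratic forms in the pressure differences
(`sum_schemeReg_mul`). The accumulation terms are bounded below by data of the old time step.

Two facts make these forms coercive although stiffness coefficients may be negative and mobilities
may vanish. Negative edges carry the smallest mobility of the triangle, and ellipticity of `Λ` lets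
the positive edges absorb them (`exists_stiffnessPos_le`, `le_sum_mul_stiffness_sq`). On a positive
edge, upwinding makes the two phase energies together dominate `m₀` times the squared increment of
the global pressure (`upwind_global_pressure_le`). The estimate thus controls the global pressure
uniformly, and the phase pressures and `p_g - p_w` with weights `ε` and `η`.

For `ε = 0`, at a vertex with minimal negative saturation the accumulation is nonpositive and every
flux is nonnegative, so all of them vanish. The `η`-term then carries the minimum along positive
edges, hence through the mesh, up to a Dirichlet vertex, where it cannot be negative
(`sat_nonneg_of_schemeReg_eq_zero`).

For `ε > 0`, with the potentials as unknowns, the energy pairing says that the scheme is a vector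
field pointing outwards on a large sphere, so it has a zero by a form of Brouwer's theorem, derived
here from the no-retraction theorem. Compactness then gives solutions as `ε → 0` at fixed `η`. The
maximum principle bounds `p_g - p_w` independently of `η`, which permits `η → 0`. -/

namespace CVFE

/-! ### Brouwer's theorem by the volume-polynomial argument. -/

section Brouwer

variable {E : Type*} [NormedAddCommGroup E] [InnerProductSpace ℝ E]

theorem exists_segment_inter_sphere {x y : E} (hx : ‖x‖ ≤ 1) (hy : 1 ≤ ‖y‖) :
    ∃ w : E, ‖w‖ = 1 ∧ ‖x - w‖ ≤ ‖x - y‖ := by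
  have hc : ContinuousOn (fun s : ℝ => ‖x + s • (y - x)‖) (Icc 0 1) := by fun_prop
  obtain ⟨s, hs, h1⟩ := intermediate_value_Icc zero_le_one hc
    (show (1 : ℝ) ∈ _ by simp [hx, hy])
  refine ⟨x + s • (y - x), h1, ?_⟩
  rw [sub_add_cancel_left, norm_neg, norm_smul, Real.norm_of_nonneg hs.1, norm_sub_rev y x]
  exact mul_le_of_le_one_left (norm_nonneg _) hs.2

variable [FiniteDimensional ℝ E]

/-- Along the segment `1 + s • A` the kernel stays trivial, so the determinant cannot change sign
from its value at `s = 0`. -/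
theorem det_one_add_pos {A : E →L[ℝ] E} (hA : ‖A‖ < 1) : 0 < (1 + A).det := by
  have hne : ∀ s ∈ Icc (0 : ℝ) 1, (1 + s • A).det ≠ 0 := by
    intro s hs hdet
    have hlt := LinearMap.bot_lt_ker_of_det_eq_zero (f := ((1 + s • A : E →L[ℝ] E) : E →ₗ[ℝ] E)) hdet
    obtain ⟨v, hv, hv0⟩ := (Submodule.ne_bot_iff _).1 hlt.ne'
    have h1 : v = -(s • A v) := by
      have : v + s • A v = 0 := by simpa using hv
      exact eq_neg_of_add_eq_zero_left this
    have h2 : ‖v‖ ≤ ‖A‖ * ‖v‖ := by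
      calc ‖v‖ = ‖s • A v‖ := by conv_lhs => rw [h1, norm_neg]
        _ = s * ‖A v‖ := by rw [norm_smul, Real.norm_of_nonneg hs.1]
        _ ≤ 1 * ‖A v‖ := by gcongr; exact hs.2
        _ ≤ ‖A‖ * ‖v‖ := by rw [one_mul]; exact A.le_opNorm v
    have h3 : 0 < ‖v‖ := norm_pos_iff.2 hv0
    nlinarith
  have hcont : ContinuousOn (fun s : ℝ => (1 + s • A).det) (Icc 0 1) :=
    (ContinuousLinearMap.continuous_det.comp (by fun_prop)).continuousOn
  by_contra! hneg
  have h0 : (1 + (0 : ℝ) • A).det = 1 := by simp [ContinuousLinearMap.det]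
  have h1 : (1 + (1 : ℝ) • A).det ≤ 0 := by simpa using hneg
  obtain ⟨s, hs, hs0⟩ := intermediate_value_Icc' zero_le_one hcont
    ⟨h1, by simp only [h0]; exact zero_le_one⟩
  exact hne s hs hs0

theorem exists_polynomial_det_one_add (A : E →L[ℝ] E) :
    ∃ P : Polynomial ℝ, P.natDegree ≤ Module.finrank ℝ E ∧
      ∀ t : ℝ, P.eval t = (1 + t • A).det := by
  let b := Module.finBasis ℝ E
  let m := LinearMap.toMatrix b b (A : E →ₗ[ℝ] E)
  refine ⟨Matrix.det ((Polynomial.X : Polynomial ℝ) • m.map Polynomial.C +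
    (1 : Matrix _ _ ℝ).map Polynomial.C), ?_, fun t => ?_⟩
  · simpa using Polynomial.natDegree_det_X_add_C_le m 1
  · rw [ContinuousLinearMap.det, ← LinearMap.det_toMatrix b, ← Polynomial.coe_evalRingHom,
      RingHom.map_det]
    congr 1
    have h1 : LinearMap.toMatrix b b ((1 + t • A : E →L[ℝ] E) : E →ₗ[ℝ] E) = 1 + t • m := by
      rw [← LinearMap.toMatrix_one b, ← map_smul, ← map_add]
      rfl
    rw [h1]
    ext i j
    by_cases hij : i = j
    · subst hij
      simp [add_comm, mul_comm t]
    · simp [hij, mul_comm t]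

/-- Lagrange interpolation at `n + 1` small nodes, with weights independent of the polynomial. It
transports an identity between integrals from small parameters to the parameter `1`. -/
theorem exists_extrapolation (t₀ : ℝ) (ht₀ : 0 < t₀) (n : ℕ) :
    ∃ v c : ℕ → ℝ, (∀ i, 0 < v i ∧ v i ≤ t₀) ∧ ∑ i ∈ Finset.range (n + 1), c i = 1 ∧
      ∀ P : Polynomial ℝ, P.natDegree ≤ n →
        P.eval 1 = ∑ i ∈ Finset.range (n + 1), c i * P.eval (v i) := by
  let v : ℕ → ℝ := fun i => t₀ / (i + 1)
  have hv : Set.InjOn v (Finset.range (n + 1)) := by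
    intro i _ j _ hij
    have h : t₀ / ((i : ℝ) + 1) = t₀ / ((j : ℝ) + 1) := hij
    rw [div_eq_div_iff (by positivity) (by positivity)] at h
    exact_mod_cast (add_right_cancel (mul_left_cancel₀ ht₀.ne' h)).symm
  refine ⟨v, fun i => (Lagrange.basis (Finset.range (n + 1)) v i).eval 1, fun i => ⟨by positivity, ?_⟩,
    ?_, fun P hP => ?_⟩
  · exact div_le_self ht₀.le (by linarith [(Nat.cast_nonneg i : (0 : ℝ) ≤ i)])
  · rw [← Polynomial.eval_finsetSum, Lagrange.sum_basis hv (by simp), Polynomial.eval_one]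
  · have hdeg : P.degree < (Finset.range (n + 1)).card := by
      rw [Finset.card_range]
      exact lt_of_le_of_lt Polynomial.degree_le_natDegree (by exact_mod_cast Nat.lt_succ_of_le hP)
    conv_lhs => rw [Lagrange.eq_interpolate hv hdeg]
    rw [Lagrange.interpolate_apply, Polynomial.eval_finsetSum]
    refine Finset.sum_congr rfl fun i _ => ?_
    rw [Polynomial.eval_mul, Polynomial.eval_C, mul_comm]


/-- A small Lipschitz perturbation of the identity which vanishes on the sphere maps the unit ball
bijectively onto itself. -/
theorem bijOn_closedBall_id_add {g : E → E} {C t : ℝ} (hC : 0 ≤ C)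
    (hg : ∀ x ∈ Metric.closedBall (0 : E) 1, ∀ y ∈ Metric.closedBall (0 : E) 1,
      ‖g x - g y‖ ≤ C * ‖x - y‖)
    (hg0 : ∀ x, ‖x‖ = 1 → g x = 0) (ht : 0 ≤ t) (htC : t * C < 1)
    (hmaps : MapsTo (fun x => x + t • g x) (Metric.closedBall (0 : E) 1) (Metric.closedBall 0 1)) :
    BijOn (fun x => x + t • g x) (Metric.closedBall (0 : E) 1) (Metric.closedBall 0 1) := by
  classical
  refine ⟨hmaps, fun x hx y hy hxy => ?_, fun y hy => ?_⟩
  · have h1 : x - y = t • (g y - g x) := by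
      rw [smul_sub]
      have : x + t • g x = y + t • g y := hxy
      rw [sub_eq_sub_iff_add_eq_add, this, add_comm]
    have h2 : ‖x - y‖ ≤ t * (C * ‖x - y‖) := by
      conv_lhs => rw [h1, norm_smul, Real.norm_of_nonneg ht, norm_sub_rev]
      gcongr
      exact hg x hx y hy
    have h3 : ‖x - y‖ ≤ 0 := by nlinarith [norm_nonneg (x - y)]
    exact sub_eq_zero.1 (norm_le_zero_iff.1 h3)
  -- Surjectivity is Banach's fixed point theorem for `x ↦ y - t • G x`. The extension by zero keeps
  -- the Lipschitz constant, since a segment leaving the ball meets the sphere, where `g` vanishes.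
  -- A fixed point outside the ball would equal `y`.
  · let G : E → E := fun x => if ‖x‖ ≤ 1 then g x else 0
    have hmix : ∀ x z : E, ‖x‖ ≤ 1 → ¬ ‖z‖ ≤ 1 → ‖g x‖ ≤ C * ‖x - z‖ := by
      intro x z hx hz
      obtain ⟨w, hw1, hw2⟩ := exists_segment_inter_sphere hx (not_le.1 hz).le
      have h := hg x (by simpa using hx) w (by simp [hw1])
      rw [hg0 w hw1, sub_zero] at h
      exact h.trans (by gcongr)
    have hG : ∀ x z, ‖G x - G z‖ ≤ C * ‖x - z‖ := by
      intro x z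
      by_cases hx : ‖x‖ ≤ 1 <;> by_cases hz : ‖z‖ ≤ 1 <;> simp only [G, hx, hz, if_true, if_false]
      · exact hg x (by simpa using hx) z (by simpa using hz)
      · simpa using hmix x z hx hz
      · simpa [norm_sub_rev] using hmix z x hz hx
      · simpa using by positivity
    have hcontr : ContractingWith (Real.toNNReal (t * C)) (fun x => y - t • G x) := by
      refine ⟨Real.toNNReal_lt_one.2 htC, LipschitzWith.of_dist_le_mul fun x z => ?_⟩
      rw [dist_eq_norm, dist_eq_norm, sub_sub_sub_cancel_left, ← smul_sub, norm_smul,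
        Real.norm_of_nonneg ht, norm_sub_rev, Real.coe_toNNReal _ (by positivity), mul_assoc]
      gcongr
      exact hG x z
    have hfix := hcontr.fixedPoint_isFixedPt
    set x := ContractingWith.fixedPoint _ hcontr
    have hx : y - t • G x = x := hfix
    have hx1 : ‖x‖ ≤ 1 := by
      by_contra hx1
      simp only [G, hx1, if_false, smul_zero, sub_zero] at hx
      exact hx1 (hx ▸ by simpa using hy)
    refine ⟨x, by simpa using hx1, ?_⟩
    simp only [G, hx1, if_true] at hx
    show x + t • g x = y
    rw [← hx, hx]
    exact (eq_add_of_sub_eq hx).symm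

/-- Differentiating `‖r‖² = 1` shows that the range of the derivative is orthogonal to the nonzero
vector `r x`. -/
theorem det_eq_zero_of_norm_eq_one {r : E → E} {U : Set E} (hU : IsOpen U)
    (hr : ∀ x ∈ U, ‖r x‖ = 1) {x : E} (hx : x ∈ U) (hd : DifferentiableAt ℝ r x) :
    (fderiv ℝ r x).det = 0 := by
  by_contra hdet
  have hunit : IsUnit (fderiv ℝ r x : E →ₗ[ℝ] E) :=
    (LinearMap.isUnit_iff_isUnit_det _).2 (isUnit_iff_ne_zero.2 hdet)
  have hsurj : Function.Surjective (fderiv ℝ r x) :=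
    ((Module.End.isUnit_iff _).1 hunit).surjective
  obtain ⟨v, hv⟩ := hsurj (r x)
  have hconst : (fun y => inner ℝ (r y) (r y)) =ᶠ[nhds x] fun _ => (1 : ℝ) := by
    filter_upwards [hU.mem_nhds hx] with y hy
    rw [real_inner_self_eq_norm_sq, hr y hy, one_pow]
  have h1 := hd.hasFDerivAt.inner ℝ hd.hasFDerivAt
  have h2 : HasFDerivAt (fun y => inner ℝ (r y) (r y)) (0 : E →L[ℝ] ℝ) x :=
    (hasFDerivAt_const (1 : ℝ) x).congr_of_eventuallyEq hconst
  have h3 := congrArg (fun l : E →L[ℝ] ℝ => l v) (h1.unique h2)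
  simp [hv, hr x hx] at h3

/-- There is no `C¹` retraction of the unit ball onto the unit sphere. -/
theorem not_exists_contDiffOn_retraction {r : E → E} {U : Set E} (hU : IsOpen U)
    (hBU : Metric.closedBall 0 1 ⊆ U) (hrd : ContDiffOn ℝ 1 r U) (hr1 : ∀ x ∈ U, ‖r x‖ = 1)
    (hrS : ∀ x, ‖x‖ = 1 → r x = x) : False := by
  borelize E
  set B : Set E := Metric.closedBall 0 1 with hB
  have hBc : IsCompact B := isCompact_closedBall 0 1
  have hdiff : ∀ x ∈ U, DifferentiableAt ℝ r x := fun x hx =>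
    (hrd.differentiableOn one_ne_zero).differentiableAt (hU.mem_nhds hx)
  have hcont : ContinuousOn (fun x => fderiv ℝ r x) B :=
    (hrd.continuousOn_fderiv_of_isOpen hU le_rfl).mono hBU
  let A : E → E →L[ℝ] E := fun x => fderiv ℝ r x - 1
  have hAc : ContinuousOn A B := hcont.sub continuousOn_const
  obtain ⟨C, hC⟩ := hBc.exists_bound_of_continuousOn hAc
  have hC0 : 0 ≤ C := (norm_nonneg _).trans (hC 0 (by simp [hB]))
  let g : E → E := fun x => r x - x
  have hgd : ∀ x ∈ B, HasFDerivWithinAt g (A x) B x := fun x hx =>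
    ((hdiff x (hBU hx)).hasFDerivAt.sub (hasFDerivAt_id x)).hasFDerivWithinAt
  have hgL : ∀ x ∈ B, ∀ y ∈ B, ‖g x - g y‖ ≤ C * ‖x - y‖ := fun x hx y hy =>
    (convex_closedBall (0 : E) 1).norm_image_sub_le_of_norm_hasFDerivWithin_le hgd hC hy hx
  -- For small `t` the map `x ↦ x + t • g x` is a bijection of the ball with positive Jacobian, so
  -- the change of variables returns the volume of the ball.
  have hvol : ∀ t : ℝ, 0 < t → t ≤ 1 / (C + 1) →
      ∫ x in B, (1 + t • A x).det = volume.real B := by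
    intro t ht htC
    have htC' : t * C < 1 := by
      rw [le_div_iff₀ (by positivity)] at htC
      nlinarith
    have ht1 : t ≤ 1 := htC.trans (by rw [div_le_one (by positivity)]; linarith)
    have hbij := bijOn_closedBall_id_add (g := g) hC0 hgL
      (fun x hx => by simp [g, hrS x hx]) ht.le htC' (by
        intro x hx
        have hx' : ‖x‖ ≤ 1 := by simpa [hB] using hx
        have : x + t • g x = (1 - t) • x + t • r x := by
          simp only [g, smul_sub, sub_smul, one_smul]; abel
        simp only [mem_closedBall_zero_iff, this]
        calc _ ≤ ‖(1 - t) • x‖ + ‖t • r x‖ := norm_add_le _ _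
          _ = (1 - t) * ‖x‖ + t * 1 := by
            rw [norm_smul, norm_smul, Real.norm_of_nonneg ht.le,
              Real.norm_of_nonneg (sub_nonneg.2 ht1), hr1 x (hBU hx)]
          _ ≤ (1 - t) * 1 + t * 1 := by
            gcongr
          _ = 1 := by ring)
    have hint := integral_image_eq_integral_abs_det_fderiv_smul (volume : Measure E)
      (s := B) (f := fun x => x + t • g x) (f' := fun x => 1 + t • A x) hBc.measurableSet
      (fun x hx => (hasFDerivWithinAt_id x B).add ((hgd x hx).const_smul t)) hbij.injOn
      (fun _ => (1 : ℝ))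
    rw [hbij.image_eq] at hint
    simp only [smul_eq_mul, mul_one, integral_const, MeasurableSet.univ, measureReal_restrict_apply,
      univ_inter] at hint
    rw [hint]
    refine setIntegral_congr_fun hBc.measurableSet fun x hx => ?_
    refine (abs_of_pos (det_one_add_pos ?_)).symm
    rw [norm_smul, Real.norm_of_nonneg ht.le]
    exact (mul_le_mul_of_nonneg_left (hC x hx) ht.le).trans_lt htC'
  -- The Jacobian is polynomial in `t`, so the volume identity extends to `t = 1`; there the map is
  -- `r`, whose Jacobian vanishes.
  obtain ⟨v, c, hv, hc1, hvc⟩ := exists_extrapolation (1 / (C + 1)) (by positivity)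
    (Module.finrank ℝ E)
  have hpt : ∀ x, (1 + (1 : ℝ) • A x).det =
      ∑ i ∈ Finset.range (Module.finrank ℝ E + 1), c i * (1 + v i • A x).det := by
    intro x
    obtain ⟨P, hP, hPe⟩ := exists_polynomial_det_one_add (A x)
    simpa only [hPe] using hvc P hP
  have hzero : ∀ x ∈ B, (1 + (1 : ℝ) • A x).det = 0 := by
    intro x hx
    rw [one_smul, add_sub_cancel]
    exact det_eq_zero_of_norm_eq_one hU hr1 (hBU hx) (hdiff x (hBU hx))
  have hfin : ∫ x in B, (1 + (1 : ℝ) • A x).det = volume.real B := by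
    simp only [hpt]
    rw [integral_finsetSum]
    · simp only [integral_const_mul]
      rw [Finset.sum_congr rfl fun i _ => by rw [hvol (v i) (hv i).1 (hv i).2], ← Finset.sum_mul,
        hc1, one_mul]
    · intro i _
      have hI : IntegrableOn (fun x => (1 + v i • A x).det) B volume :=
        ContinuousOn.integrableOn_compact hBc (ContinuousLinearMap.continuous_det.comp_continuousOn
          (by fun_prop))
      exact Integrable.const_mul hI _
  rw [setIntegral_congr_fun hBc.measurableSet hzero, integral_zero] at hfin
  have hpos : 0 < volume.real B :=
    ENNReal.toReal_pos (Metric.measure_closedBall_pos _ _ one_pos).ne' hBc.measure_lt_top.ne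
  exact hpos.ne hfin

/-- Without a zero, following the direction `g x` from `x` to the unit sphere gives a `C¹`
retraction: `τ` is the larger root of `‖x + τ • g x‖² = 1`, and the outward condition makes it `0`
on the sphere and keeps the discriminant positive there. -/
theorem exists_zero_of_contDiff {g : E → E} (hg : ContDiff ℝ 1 g)
    (hS : ∀ x, ‖x‖ = 1 → 0 < inner ℝ (g x) x) : ∃ x ∈ Metric.closedBall (0 : E) 1, g x = 0 := by
  by_contra! hne
  let disc : E → ℝ := fun x => inner ℝ (g x) x ^ 2 + ‖g x‖ ^ 2 * (1 - ‖x‖ ^ 2)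
  let τ : E → ℝ := fun x => (-inner ℝ (g x) x + √(disc x)) / ‖g x‖ ^ 2
  let r : E → E := fun x => x + τ x • g x
  let U : Set E := {x | g x ≠ 0} ∩ {x | 0 < disc x}
  have hgc := hg.continuous
  have hdc : ContDiff ℝ 1 disc :=
    ((hg.inner ℝ contDiff_id).pow 2).add ((hg.norm_sq ℝ).mul (contDiff_const.sub (contDiff_norm_sq ℝ)))
  have hU : IsOpen U := (isOpen_ne_fun hgc continuous_const).inter
    (isOpen_lt continuous_const hdc.continuous)
  refine not_exists_contDiffOn_retraction (r := r) hU ?_ ?_ ?_ ?_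
  · intro x hx
    have hgx := hne x hx
    have hx1 : ‖x‖ ≤ 1 := by simpa using hx
    have hgp : 0 < ‖g x‖ := norm_pos_iff.2 hgx
    refine ⟨hgx, ?_⟩
    rcases hx1.lt_or_eq with h | h
    · have : 0 < 1 - ‖x‖ ^ 2 := by nlinarith [norm_nonneg x]
      exact add_pos_of_nonneg_of_pos (sq_nonneg (inner ℝ (g x) x : ℝ)) (by positivity)
    · have := hS x h
      show 0 < inner ℝ (g x) x ^ 2 + ‖g x‖ ^ 2 * (1 - ‖x‖ ^ 2)
      rw [h]
      simpa using by positivity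
  · intro x hx
    have hd : ContDiffAt ℝ 1 (fun y => √(disc y)) x := hdc.contDiffAt.sqrt hx.2.ne'
    have hn : ‖g x‖ ^ 2 ≠ 0 := pow_ne_zero _ (norm_ne_zero_iff.2 hx.1)
    exact (contDiffAt_id.add ((((hg.inner ℝ contDiff_id).contDiffAt.neg.add hd).div
      (hg.norm_sq ℝ).contDiffAt hn).smul hg.contDiffAt)).contDiffWithinAt
  · intro x hx
    have hn : ‖g x‖ ^ 2 ≠ 0 := pow_ne_zero _ (norm_ne_zero_iff.2 hx.1)
    have hs : √(disc x) ^ 2 = disc x := Real.sq_sqrt hx.2.le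
    have hτ : τ x * ‖g x‖ ^ 2 = -inner ℝ (g x) x + √(disc x) := div_mul_cancel₀ _ hn
    have h1 : ‖r x‖ ^ 2 = 1 := by
      show ‖x + τ x • g x‖ ^ 2 = 1
      rw [norm_add_sq_real, inner_smul_right, norm_smul, mul_pow, Real.norm_eq_abs, sq_abs,
        real_inner_comm]
      apply mul_right_cancel₀ hn
      have : disc x = inner ℝ (g x) x ^ 2 + ‖g x‖ ^ 2 * (1 - ‖x‖ ^ 2) := rfl
      generalize hT : inner ℝ (g x) x = a at *
      generalize τ x = b at *
      generalize √(disc x) = e at *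
      have hb : (b * ‖g x‖ ^ 2 + a) ^ 2 = disc x := by rw [hτ, ← hs]; ring
      rw [this] at hb
      linear_combination hb
    exact (pow_eq_one_iff_of_nonneg (norm_nonneg _) two_ne_zero).1 h1
  · intro x hx
    have h0 := hS x hx
    have : τ x = 0 := by
      simp only [τ, disc, hx]
      rw [one_pow, sub_self, mul_zero, add_zero, Real.sqrt_sq h0.le, neg_add_cancel, zero_div]
    simp [r, this]

/-- A `C¹` approximation closer than half the minima of `‖G‖` on the ball and of `⟨G x, x⟩` on the
sphere still points outwards, and its zero would contradict the first minimum. -/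
theorem exists_zero_of_continuous_unit {G : E → E} (hG : Continuous G)
    (hS : ∀ x, ‖x‖ = 1 → 0 < inner ℝ (G x) x) : ∃ x, G x = 0 := by
  by_contra! hne
  obtain ⟨a, ha, hGa⟩ : ∃ a > 0, ∀ x ∈ Metric.closedBall (0 : E) 1, a ≤ ‖G x‖ :=
    (isCompact_closedBall (0 : E) 1).exists_forall_le' hG.norm.continuousOn
      (fun x _ => norm_pos_iff.2 (hne x))
  obtain ⟨b, hb, hGb⟩ : ∃ b > 0, ∀ x ∈ Metric.sphere (0 : E) 1, b ≤ inner ℝ (G x) x :=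
    (isCompact_sphere (0 : E) 1).exists_forall_le' (hG.inner continuous_id).continuousOn
      (fun x hx => hS x (by simpa using hx))
  let δ := min a b / 2
  have hδ : 0 < δ := by positivity
  obtain ⟨g, hg⟩ := exists_contMDiffMap_forall_mem_convex_of_local_const (modelWithCornersSelf ℝ E)
    (n := 1) (t := fun x => Metric.ball (G x) δ) (fun x => convex_ball _ _)
    (fun x => ⟨G x, by
      have := hG.continuousAt.eventually (Metric.ball_mem_nhds (G x) hδ)
      filter_upwards [this] with y hy
      exact Metric.mem_ball_comm.1 hy⟩)
  have hgd : ContDiff ℝ 1 (g : E → E) := g.contMDiff.contDiff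
  have hgn : ∀ x, ‖g x - G x‖ < δ := fun x => by simpa [dist_eq_norm] using hg x
  obtain ⟨x, hx, hx0⟩ := exists_zero_of_contDiff hgd (fun x hx => by
    have h1 := hGb x (by simpa using hx)
    have h2 : inner ℝ (g x) x = inner ℝ (G x) x + inner ℝ (g x - G x) x := by
      rw [← inner_add_left, add_sub_cancel]
    have h3 := (abs_le.1 (abs_real_inner_le_norm (g x - G x) x)).1
    rw [hx, mul_one] at h3
    have := hgn x
    have : δ ≤ b / 2 := div_le_div_of_nonneg_right (min_le_right _ _) two_pos.le
    linarith)
  have h1 := hGa x hx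
  have h2 := hgn x
  rw [hx0, zero_sub, norm_neg] at h2
  have : δ ≤ a / 2 := div_le_div_of_nonneg_right (min_le_left _ _) two_pos.le
  linarith

/-- A continuous vector field which points outwards on a sphere has a zero. -/
theorem exists_zero_of_continuous {G : E → E} (hG : Continuous G) {R : ℝ} (hR : 0 < R)
    (hS : ∀ x, ‖x‖ = R → 0 < inner ℝ (G x) x) : ∃ x, G x = 0 := by
  obtain ⟨x, hx⟩ := exists_zero_of_continuous_unit (G := fun x => G (R • x)) (by fun_prop)
    (fun x hx => by
      have h := hS (R • x) (by rw [norm_smul, hx, mul_one, Real.norm_of_nonneg hR.le])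
      rw [inner_smul_right] at h
      exact (mul_pos_iff_of_pos_left hR).1 h)
  exact ⟨_, hx⟩

end Brouwer
-- Geometry of the mesh, discrete gradients and the Poincaré inequality.
namespace TriMesh

variable {V : Type*} [DecidableEq V] {Ω : Set Plane} (M : TriMesh V Ω)

theorem inner_shapeGrad (T : M.cells) (K : V) (x v : Plane) :
    inner ℝ (M.shapeGrad T K x) v = (M.shape T K).linear v := by
  have h : HasFDerivAt (fun y => M.shape T K y)
      (LinearMap.toContinuousLinearMap (M.shape T K).linear) x := by
    rw [AffineMap.decomp (M.shape T K)]
    exact ((LinearMap.toContinuousLinearMap (M.shape T K).linear).hasFDerivAt).add_const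
      (M.shape T K 0)
  rw [shapeGrad, gradient, InnerProductSpace.toDual_symm_apply, h.fderiv]
  rfl

theorem shapeGrad_eq (T : M.cells) (K : V) (x y : Plane) :
    M.shapeGrad T K x = M.shapeGrad T K y :=
  ext_inner_right ℝ fun v => by rw [inner_shapeGrad, inner_shapeGrad]

theorem shapeGrad_of_notMem {T : M.cells} {K : V} (hK : K ∉ T.1) (x : Plane) :
    M.shapeGrad T K x = 0 :=
  ext_inner_right ℝ fun v => by
    rw [inner_shapeGrad, shape, dif_neg hK, inner_zero_left]; rfl

theorem basis_apply (T : M.cells) (K : T.1) : M.basis T K = M.pos K := rfl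

theorem shape_pos (T : M.cells) (K : V) {L : V} (hL : L ∈ T.1) :
    M.shape T K (M.pos L) = if K = L then 1 else 0 := by
  by_cases hK : K ∈ T.1
  · rw [shape, dif_pos hK]
    simpa [basis_apply] using (M.basis T).coord_apply ⟨K, hK⟩ ⟨L, hL⟩
  · rw [shape, dif_neg hK, if_neg (by rintro rfl; exact hK hL)]
    rfl

theorem sum_shapeGrad (T : M.cells) (x : Plane) : ∑ K ∈ T.1, M.shapeGrad T K x = 0 := by
  refine ext_inner_right ℝ fun v => ?_
  rw [inner_zero_left, sum_inner]
  have h1 : ∀ q : Plane, ∑ K ∈ T.1, M.shape T K q = 1 := by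
    intro q
    rw [← (M.basis T).sum_coord_apply_eq_one q, ← Finset.sum_coe_sort]
    refine Finset.sum_congr rfl fun K _ => ?_
    rw [shape, dif_pos K.2]
  have h2 : ∀ K, inner ℝ (M.shapeGrad T K x) v = M.shape T K v - M.shape T K 0 := by
    intro K
    rw [inner_shapeGrad]
    simpa using (M.shape T K).linearMap_vsub v 0
  simp only [h2, Finset.sum_sub_distrib, h1, sub_self]

theorem triangle_isCompact (T : M.cells) : IsCompact (M.triangle T) :=
  (T.1.finite_toSet.image _).isCompact_convexHull ℝ

theorem triangle_subset (T : M.cells) : M.triangle T ⊆ closure Ω := by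
  rw [← M.cover]
  exact subset_iUnion₂ (s := fun (T : Finset V) (_ : T ∈ M.cells) =>
    convexHull ℝ (M.pos '' (T : Set V))) T.1 T.2

theorem volume_triangle_lt_top (T : M.cells) : volume (M.triangle T) < ⊤ :=
  (M.triangle_isCompact T).measure_lt_top

theorem volume_triangle_pos (T : M.cells) : 0 < volume.real (M.triangle T) := by
  have hr : Set.range (M.basis T) = M.pos '' (T.1 : Set V) := by
    ext x
    simp [basis_apply]
  have hc := (M.basis T).centroid_mem_interior_convexHull
  rw [hr] at hc
  exact ENNReal.toReal_pos (Measure.measure_pos_of_nonempty_interior _ ⟨_, hc⟩).ne'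
    (M.volume_triangle_lt_top T).ne

theorem pos_mem_triangle (T : M.cells) {K : V} (hK : K ∈ T.1) : M.pos K ∈ M.triangle T :=
  subset_convexHull ℝ _ ⟨K, hK, rfl⟩

/-- A set of vertices which is stable under adjacency in triangles contains all vertices. -/
theorem mem_of_propagation (hΩ : IsConnected Ω) {A : Set V} (hA : A.Nonempty)
    (h : ∀ T : M.cells, ∀ K ∈ T.1, K ∈ A → ∀ L ∈ T.1, L ∈ A) (K : V) : K ∈ A := by
  by_contra hK
  let C : Set M.cells := {T | ∃ J ∈ T.1, J ∈ A}
  have hcl : ∀ S : Set M.cells, IsClosed (⋃ T ∈ S, M.triangle T) := fun S =>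
    S.toFinite.isClosed_biUnion fun T _ => (M.triangle_isCompact T).isClosed
  -- The triangles touching `A` and the others form two closed sets covering the connected set
  -- `closure Ω`, so they meet. Conformity then yields a common vertex, which the hypothesis puts in
  -- `A`.
  have hpre := isPreconnected_closed_iff.1 hΩ.isPreconnected.closure _ _ (hcl C) (hcl Cᶜ)
  obtain ⟨K₀, hK₀⟩ := hA
  obtain ⟨T₀, hT₀, hKT₀⟩ := M.exists_cell K₀
  obtain ⟨T₁, hT₁, hKT₁⟩ := M.exists_cell K
  obtain ⟨x, -, hx1, hx2⟩ := hpre (by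
      rw [← M.cover]
      intro x hx
      obtain ⟨T, hT, hxT⟩ := mem_iUnion₂.1 hx
      by_cases hTC : (⟨T, hT⟩ : M.cells) ∈ C
      · exact Or.inl (mem_biUnion hTC hxT)
      · exact Or.inr (mem_biUnion hTC hxT))
    ⟨M.pos K₀, M.triangle_subset ⟨T₀, hT₀⟩ (M.pos_mem_triangle _ hKT₀),
      mem_biUnion (show (⟨T₀, hT₀⟩ : M.cells) ∈ C from ⟨K₀, hKT₀, hK₀⟩)
        (M.pos_mem_triangle _ hKT₀)⟩
    ⟨M.pos K, M.triangle_subset ⟨T₁, hT₁⟩ (M.pos_mem_triangle _ hKT₁),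
      mem_biUnion (show (⟨T₁, hT₁⟩ : M.cells) ∈ Cᶜ from
        fun ⟨J, hJ, hJA⟩ => hK (h ⟨T₁, hT₁⟩ J hJ hJA K hKT₁)) (M.pos_mem_triangle _ hKT₁)⟩
  obtain ⟨T, ⟨J, hJ, hJA⟩, hxT⟩ := mem_iUnion₂.1 hx1
  obtain ⟨T', hT', hxT'⟩ := mem_iUnion₂.1 hx2
  have hx := M.conforming T.1 T.2 T'.1 T'.2 ⟨hxT, hxT'⟩
  obtain ⟨-, L, hL, -⟩ := convexHull_nonempty_iff.1 ⟨x, hx⟩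
  have hL' := Finset.mem_inter.1 (Finset.mem_coe.1 hL)
  exact hT' ⟨L, hL'.2, h T J hJ hJA L hL'.1⟩

section Grad

variable [Fintype V]

/-- The gradient on the triangle `T` of the piecewise affine function with nodal values `f`. -/
noncomputable def cellGrad (T : M.cells) (f : V → ℝ) : Plane := ∑ K, f K • M.shapeGrad T K 0

theorem sum_smul_shapeGrad (T : M.cells) (f : V → ℝ) (x : Plane) :
    ∑ K, f K • M.shapeGrad T K x = M.cellGrad T f :=
  Finset.sum_congr rfl fun K _ => by rw [M.shapeGrad_eq T K x 0]

theorem cellGrad_eq_sum_cell (T : M.cells) (f : V → ℝ) :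
    M.cellGrad T f = ∑ K ∈ T.1, f K • M.shapeGrad T K 0 := by
  rw [cellGrad, eq_comm]
  refine Finset.sum_subset (Finset.subset_univ _) fun K _ hK => ?_
  rw [M.shapeGrad_of_notMem hK, smul_zero]

theorem inner_cellGrad (T : M.cells) (f : V → ℝ) {K L : V} (hK : K ∈ T.1) (hL : L ∈ T.1) :
    inner ℝ (M.cellGrad T f) (M.pos L - M.pos K) = f L - f K := by
  have h (J : V) : (M.shape T J).linear (M.pos L - M.pos K) =
      M.shape T J (M.pos L) - M.shape T J (M.pos K) := by
    simpa using (M.shape T J).linearMap_vsub (M.pos L) (M.pos K)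
  simp [cellGrad, sum_inner, inner_smul_left, inner_shapeGrad, h, M.shape_pos T _ hL,
    M.shape_pos T _ hK, mul_sub, Finset.sum_sub_distrib]

theorem abs_sub_le_cellGrad (T : M.cells) (f : V → ℝ) {K L : V} (hK : K ∈ T.1) (hL : L ∈ T.1) :
    |f L - f K| ≤ ‖M.cellGrad T f‖ * ‖M.pos L - M.pos K‖ := by
  rw [← M.inner_cellGrad T f hK hL]
  exact abs_real_inner_le_norm _ _

theorem gradNorm_nonneg (f : V → ℝ) : 0 ≤ M.gradNorm f := Real.sqrt_nonneg _

theorem gradNorm_sq (f : V → ℝ) :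
    M.gradNorm f ^ 2 = ∑ T : M.cells, volume.real (M.triangle T) * ‖M.cellGrad T f‖ ^ 2 := by
  have h : ∀ T : M.cells, ∫ x in M.triangle T, ‖∑ K, f K • M.shapeGrad T K x‖ ^ 2 =
      volume.real (M.triangle T) * ‖M.cellGrad T f‖ ^ 2 := by
    intro T
    simp only [M.sum_smul_shapeGrad, integral_const, smul_eq_mul, MeasurableSet.univ,
      measureReal_restrict_apply, univ_inter]
  rw [gradNorm, Real.sq_sqrt (Finset.sum_nonneg fun T _ => integral_nonneg fun _ => by positivity)]
  simp only [h]

theorem gradNorm_neg (f : V → ℝ) : M.gradNorm (-f) = M.gradNorm f := by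
  simp [gradNorm, Finset.sum_neg_distrib]

theorem cellGrad_le_gradNorm (T : M.cells) (f : V → ℝ) :
    ‖M.cellGrad T f‖ ≤ M.gradNorm f / √(volume.real (M.triangle T)) := by
  rw [le_div_iff₀ (Real.sqrt_pos.2 (M.volume_triangle_pos T))]
  refine abs_le_of_sq_le_sq' ?_ (M.gradNorm_nonneg f) |>.2
  rw [mul_pow, Real.sq_sqrt (M.volume_triangle_pos T).le, gradNorm_sq, mul_comm]
  exact Finset.single_le_sum
    (f := fun T : M.cells => volume.real (M.triangle T) * ‖M.cellGrad T f‖ ^ 2)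
    (fun T _ => by positivity) (Finset.mem_univ T)

/-- Discrete Poincaré inequality. -/
theorem exists_abs_le_gradNorm (hΩ : IsConnected Ω) {ΓD : Set Plane} (hM : ∃ K, M.pos K ∈ ΓD) :
    ∃ C : ℝ, 0 < C ∧ ∀ f ∈ M.dirichletSpace ΓD, ∀ K, |f K| ≤ C * M.gradNorm f := by
  -- The set of vertices where the inequality holds contains a Dirichlet vertex and propagates
  -- across triangles.
  let A : Set V := {K | ∃ C : ℝ, ∀ f ∈ M.dirichletSpace ΓD, |f K| ≤ C * M.gradNorm f}
  have hA : ∀ K, K ∈ A := by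
    refine M.mem_of_propagation hΩ ?_ ?_
    · obtain ⟨K, hK⟩ := hM
      exact ⟨K, 0, fun f hf => by simp [show f K = 0 from hf K hK]⟩
    · rintro T K hK ⟨C, hC⟩ L hL
      refine ⟨C + ‖M.pos L - M.pos K‖ / √(volume.real (M.triangle T)), fun f hf => ?_⟩
      have h1 := hC f hf
      have h2 := M.abs_sub_le_cellGrad T f hK hL
      have h3 := mul_le_mul_of_nonneg_right (M.cellGrad_le_gradNorm T f)
        (norm_nonneg (M.pos L - M.pos K))
      have h4 : |f L| ≤ |f K| + |f L - f K| := by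
        simpa using abs_add_le (f K) (f L - f K)
      rw [add_mul]
      calc |f L| ≤ _ := h4
        _ ≤ C * M.gradNorm f +
            M.gradNorm f / √(volume.real (M.triangle T)) * ‖M.pos L - M.pos K‖ := by linarith
        _ = _ := by ring
  choose C hC using hA
  refine ⟨1 + ∑ K, |C K|, by positivity, fun f hf K => (hC K f hf).trans ?_⟩
  refine mul_le_mul_of_nonneg_right ?_ (M.gradNorm_nonneg f)
  have := Finset.single_le_sum (f := fun K => |C K|) (fun K _ => abs_nonneg _) (Finset.mem_univ K)
  have := le_abs_self (C K)
  linarith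

end Grad

theorem subcell_subset (T : M.cells) {K : V} (hK : K ∈ T.1) : M.subcell T K ⊆ M.triangle T := by
  refine convexHull_min ?_ (convex_convexHull ℝ _)
  rintro x ((rfl | rfl) | ⟨L, hL, rfl⟩)
  · exact M.pos_mem_triangle T hK
  · have hw := T.1.sum_centroidWeights_eq_one_of_nonempty ℝ (M.cell_nonempty T)
    rw [Finset.centroid, affineCombination_eq_centerMass hw]
    exact T.1.centerMass_mem_convexHull (fun _ _ => by simp)
      (by rw [hw]; exact one_pos) fun L hL => ⟨L, hL, rfl⟩
  · exact (convex_convexHull ℝ (M.pos '' (T.1 : Set V))).midpoint_mem (M.pos_mem_triangle T hK)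
      (M.pos_mem_triangle T (Finset.mem_of_mem_erase hL))

theorem controlVolume_subset (K : V) : M.controlVolume K ⊆ closure Ω :=
  iUnion₂_subset fun T hK => (M.subcell_subset T hK).trans (M.triangle_subset T)

end TriMesh
-- Stiffness coefficients and coercivity.
section Stiffness

variable {V : Type*} [DecidableEq V] {Ω : Set Plane} (M : TriMesh V Ω) (D : TwoPhaseModel Ω)

/-- The data are controlled on `Ω` only, while triangles cover its closure; the null boundary
bridges the gap. -/
theorem ae_triangle_of_ae (hΩ : volume (frontier Ω) = 0) (T : M.cells) {P : Plane → Prop}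
    (h : ∀ᵐ x ∂volume.restrict Ω, P x) : ∀ᵐ x ∂volume.restrict (M.triangle T), P x := by
  rw [← Measure.restrict_congr_set (closure_ae_eq_of_null_frontier hΩ)] at h
  exact ae_restrict_of_ae_restrict_of_subset (M.triangle_subset T) h

/-- The bounds concern only the quadratic form; symmetry and polarization extend integrability to
the bilinear form. -/
theorem integrableOn_permeability (hΩ : volume (frontier Ω) = 0) (T : M.cells) (v w : Plane) :
    IntegrableOn (fun x => inner ℝ (D.Λ x v) w : Plane → ℝ) (M.triangle T) := by
  have hmeas : AEStronglyMeasurable D.Λ (volume.restrict (M.triangle T)) := by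
    have h := D.Λ_measurable
    rw [← Measure.restrict_congr_set (closure_ae_eq_of_null_frontier hΩ)] at h
    exact h.mono_measure (Measure.restrict_mono_set _ (M.triangle_subset T))
  have hq : ∀ u : Plane, IntegrableOn (fun x => inner ℝ (D.Λ x u) u : Plane → ℝ)
      (M.triangle T) := by
    intro u
    have : IsFiniteMeasure (volume.restrict (M.triangle T)) :=
      isFiniteMeasure_restrict.2 (M.volume_triangle_lt_top T).ne
    refine Integrable.of_bound (C := D.Λ₁ * ‖u‖ ^ 2) ?_ ?_
    · exact ((ContinuousLinearMap.apply ℝ Plane u).continuous.comp_aestronglyMeasurable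
        hmeas).inner (𝕜 := ℝ) aestronglyMeasurable_const
    · filter_upwards [ae_triangle_of_ae M hΩ T D.Λ_bounds] with x hx
      rw [Real.norm_of_nonneg ((mul_nonneg D.Λ₀_pos.le (sq_nonneg _)).trans (hx u).1)]
      exact (hx u).2
  have hpol := ((hq (v + w)).sub (hq (v - w))).const_mul (1 / 4)
  refine hpol.congr ?_
  filter_upwards [ae_triangle_of_ae M hΩ T D.Λ_symm] with x hx
  have h1 : inner ℝ (D.Λ x w) v = (inner ℝ (D.Λ x v) w : ℝ) := by
    rw [hx w v, real_inner_comm]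
  simp only [Pi.sub_apply, map_add, map_sub, inner_add_left, inner_add_right, inner_sub_left,
    inner_sub_right, h1]
  ring

/-- The bilinear form `∫_T Λ v · w`. -/
noncomputable def permeabilityForm (T : M.cells) (v w : Plane) : ℝ :=
  ∫ x in M.triangle T, inner ℝ (D.Λ x v) w

theorem permeabilityForm_comm (hΩ : volume (frontier Ω) = 0) (T : M.cells) (v w : Plane) :
    permeabilityForm M D T v w = permeabilityForm M D T w v := by
  refine integral_congr_ae ?_
  filter_upwards [ae_triangle_of_ae M hΩ T D.Λ_symm] with x hx
  rw [hx v w, real_inner_comm]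

theorem permeabilityForm_sum_right (hΩ : volume (frontier Ω) = 0) (T : M.cells) (v : Plane)
    {ι : Type*} (s : Finset ι) (f : ι → ℝ) (w : ι → Plane) :
    permeabilityForm M D T v (∑ i ∈ s, f i • w i) =
      ∑ i ∈ s, f i * permeabilityForm M D T v (w i) := by
  simp only [permeabilityForm, inner_sum, inner_smul_right]
  rw [integral_finsetSum _ fun i _ => (integrableOn_permeability M D hΩ T v (w i)).const_mul (f i)]
  simp only [integral_const_mul]

theorem permeabilityForm_self (hΩ : volume (frontier Ω) = 0) (T : M.cells) (v : Plane) :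
    D.Λ₀ * volume.real (M.triangle T) * ‖v‖ ^ 2 ≤ permeabilityForm M D T v v := by
  have h : ∫ _ in M.triangle T, D.Λ₀ * ‖v‖ ^ 2 ≤ permeabilityForm M D T v v := by
    refine integral_mono_ae ?_ (integrableOn_permeability M D hΩ T v v) ?_
    · exact integrableOn_const (M.volume_triangle_lt_top T).ne
    · filter_upwards [ae_triangle_of_ae M hΩ T D.Λ_bounds] with x hx
      exact (hx v).1
  simp only [integral_const, smul_eq_mul, MeasurableSet.univ, measureReal_restrict_apply,
    univ_inter] at h
  linarith

theorem stiffness_eq (T : M.cells) (K L : V) : stiffness M D T K L =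
    -permeabilityForm M D T (M.shapeGrad T K 0) (M.shapeGrad T L 0) := by
  simp only [stiffness, permeabilityForm, M.shapeGrad_eq T _ _ 0]

theorem stiffness_comm (hΩ : volume (frontier Ω) = 0) (T : M.cells) (K L : V) :
    stiffness M D T K L = stiffness M D T L K := by
  rw [stiffness_eq, stiffness_eq, permeabilityForm_comm M D hΩ]

theorem sum_stiffness (hΩ : volume (frontier Ω) = 0) (T : M.cells) (K : V) :
    ∑ L ∈ T.1, stiffness M D T K L = 0 := by
  have h := permeabilityForm_sum_right M D hΩ T (M.shapeGrad T K 0) T.1 (fun _ => 1)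
    (fun L => M.shapeGrad T L 0)
  simp only [one_smul, one_mul, M.sum_shapeGrad] at h
  simp only [stiffness_eq, Finset.sum_neg_distrib, ← h]
  simp [permeabilityForm]

/-- Rows sum to zero and the diagonal entry is negative by ellipticity. Hence each vertex of a
triangle has an edge with positive coefficient, as the maximum principle needs. -/
theorem sum_stiffness_erase_pos (hΩ : volume (frontier Ω) = 0) (T : M.cells) {K : V}
    (hK : K ∈ T.1) : 0 < ∑ L ∈ T.1.erase K, stiffness M D T K L := by
  have h1 := sum_stiffness M D hΩ T K
  rw [← Finset.add_sum_erase _ _ hK, stiffness_eq] at h1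
  have h2 := permeabilityForm_self M D hΩ T (M.shapeGrad T K 0)
  have h3 : M.shapeGrad T K 0 ≠ 0 := by
    intro h0
    obtain ⟨L, hL⟩ : (T.1.erase K).Nonempty := by
      rw [← Finset.card_pos, Finset.card_erase_of_mem hK, M.card_cell _ T.2]
      norm_num
    have h4 := M.inner_shapeGrad T K 0 (M.pos L - M.pos K)
    have h5 := (M.shape T K).linearMap_vsub (M.pos L) (M.pos K)
    rw [M.shape_pos T K hK, M.shape_pos T K (Finset.mem_of_mem_erase hL), if_pos rfl,
      if_neg (Finset.ne_of_mem_erase hL).symm] at h5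
    rw [h0, inner_zero_left] at h4
    simp [← h4] at h5
  have h4 : 0 < D.Λ₀ * volume.real (M.triangle T) * ‖M.shapeGrad T K 0‖ ^ 2 :=
    mul_pos (mul_pos D.Λ₀_pos (M.volume_triangle_pos T)) (by positivity)
  linarith

/-- The positive part of the stiffness coefficient. -/
noncomputable def stiffnessPos (T : M.cells) (K L : V) : ℝ := max (stiffness M D T K L) 0

theorem stiffnessPos_nonneg (T : M.cells) (K L : V) : 0 ≤ stiffnessPos M D T K L :=
  le_max_right _ _

theorem stiffness_le_stiffnessPos (T : M.cells) (K L : V) :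
    stiffness M D T K L ≤ stiffnessPos M D T K L := le_max_left _ _

variable [Fintype V]

/-- In the expanded square the pure terms vanish, because rows and columns of the stiffness matrix
sum to zero. -/
theorem sum_stiffness_sq (hΩ : volume (frontier Ω) = 0) (T : M.cells) (f : V → ℝ) :
    ∑ K ∈ T.1, ∑ L ∈ T.1, stiffness M D T K L * (f L - f K) ^ 2 =
      2 * permeabilityForm M D T (M.cellGrad T f) (M.cellGrad T f) := by
  have h1 : permeabilityForm M D T (M.cellGrad T f) (M.cellGrad T f) =
      ∑ K ∈ T.1, ∑ L ∈ T.1, -(f K * f L * stiffness M D T K L) := by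
    conv_lhs => rw [M.cellGrad_eq_sum_cell T f]
    rw [permeabilityForm_sum_right M D hΩ]
    refine Finset.sum_congr rfl fun K _ => ?_
    rw [permeabilityForm_comm M D hΩ, permeabilityForm_sum_right M D hΩ, Finset.mul_sum]
    refine Finset.sum_congr rfl fun L _ => ?_
    rw [stiffness_eq]
    ring
  have h2 : ∑ K ∈ T.1, ∑ L ∈ T.1, stiffness M D T K L * f K ^ 2 = 0 :=
    Finset.sum_eq_zero fun K _ => by rw [← Finset.sum_mul, sum_stiffness M D hΩ, zero_mul]
  have h3 : ∑ K ∈ T.1, ∑ L ∈ T.1, stiffness M D T K L * f L ^ 2 = 0 := by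
    rw [Finset.sum_comm, ← h2]
    exact Finset.sum_congr rfl fun K _ => Finset.sum_congr rfl fun L _ => by
      rw [stiffness_comm M D hΩ]
  rw [h1, Finset.mul_sum]
  have h4 : ∀ K L, stiffness M D T K L * (f L - f K) ^ 2 = stiffness M D T K L * f L ^ 2 +
      stiffness M D T K L * f K ^ 2 + 2 * -(f K * f L * stiffness M D T K L) := fun K L => by ring
  simp only [h4, Finset.sum_add_distrib, h2, h3, Finset.mul_sum, zero_add]

theorem le_sum_stiffness_sq (hΩ : volume (frontier Ω) = 0) (T : M.cells) (f : V → ℝ) :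
    2 * D.Λ₀ * (volume.real (M.triangle T) * ‖M.cellGrad T f‖ ^ 2) ≤
      ∑ K ∈ T.1, ∑ L ∈ T.1, stiffness M D T K L * (f L - f K) ^ 2 := by
  rw [sum_stiffness_sq M D hΩ]
  linarith [permeabilityForm_self M D hΩ T (M.cellGrad T f)]

/-- The negative stiffness coefficients are controlled by the positive ones. -/
theorem exists_stiffnessPos_le (hΩ : volume (frontier Ω) = 0) : ∃ c : ℝ, 0 < c ∧ c ≤ 1 ∧
    ∀ (T : M.cells) (f : V → ℝ),
      c * ∑ K ∈ T.1, ∑ L ∈ T.1, stiffnessPos M D T K L * (f L - f K) ^ 2 ≤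
        ∑ K ∈ T.1, ∑ L ∈ T.1, stiffness M D T K L * (f L - f K) ^ 2 := by
  have hT : ∀ T : M.cells, ∃ c : ℝ, 0 < c ∧ ∀ f : V → ℝ,
      c * ∑ K ∈ T.1, ∑ L ∈ T.1, stiffnessPos M D T K L * (f L - f K) ^ 2 ≤
        ∑ K ∈ T.1, ∑ L ∈ T.1, stiffness M D T K L * (f L - f K) ^ 2 := by
    intro T
    set a := 2 * D.Λ₀ * volume.real (M.triangle T) with ha
    have ha0 : 0 < a := mul_pos (mul_pos two_pos D.Λ₀_pos) (M.volume_triangle_pos T)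
    set C := ∑ K ∈ T.1, ∑ L ∈ T.1, stiffnessPos M D T K L * ‖M.pos L - M.pos K‖ ^ 2 with hC
    have hC0 : 0 ≤ C := Finset.sum_nonneg fun K _ => Finset.sum_nonneg fun L _ =>
      mul_nonneg (stiffnessPos_nonneg M D T K L) (sq_nonneg _)
    -- The right side is at least `a` times the squared gradient, and the positive edges contribute
    -- at most `C` times it; the `+ 1` avoids division by zero.
    refine ⟨a / (C + 1), by positivity, fun f => ?_⟩
    have h1 : ∑ K ∈ T.1, ∑ L ∈ T.1, stiffnessPos M D T K L * (f L - f K) ^ 2 ≤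
        C * ‖M.cellGrad T f‖ ^ 2 := by
      rw [hC, Finset.sum_mul]
      refine Finset.sum_le_sum fun K hK => ?_
      rw [Finset.sum_mul]
      refine Finset.sum_le_sum fun L hL => ?_
      rw [mul_assoc]
      refine mul_le_mul_of_nonneg_left ?_ (stiffnessPos_nonneg M D T K L)
      rw [← sq_abs, ← mul_pow, mul_comm ‖_‖]
      exact pow_le_pow_left₀ (abs_nonneg _) (M.abs_sub_le_cellGrad T f hK hL) 2
    calc _ ≤ a / (C + 1) * (C * ‖M.cellGrad T f‖ ^ 2) := by gcongr
      _ ≤ a / (C + 1) * ((C + 1) * ‖M.cellGrad T f‖ ^ 2) := by gcongr; linarith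
      _ = a * ‖M.cellGrad T f‖ ^ 2 := by field_simp
      _ ≤ _ := by
        refine le_trans (le_of_eq ?_) (le_sum_stiffness_sq M D hΩ T f)
        rw [ha]; ring
  choose c hc hcf using hT
  obtain ⟨d, hd, hdc⟩ : ∃ d : ℝ, 0 < d ∧ ∀ T, d ≤ c T := by
    rcases isEmpty_or_nonempty M.cells with h | h
    · exact ⟨1, one_pos, fun T => h.elim T⟩
    · obtain ⟨T₀, hT₀⟩ := Finite.exists_min c
      exact ⟨c T₀, hc T₀, hT₀⟩
  refine ⟨min d 1, by positivity, min_le_right _ _, fun T f => le_trans ?_ (hcf T f)⟩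
  refine mul_le_mul_of_nonneg_right ((min_le_left _ _).trans (hdc T)) ?_
  exact Finset.sum_nonneg fun K _ => Finset.sum_nonneg fun L _ =>
    mul_nonneg (stiffnessPos_nonneg M D T K L) (sq_nonneg _)

/-- Coercivity of the upwinded diffusion form: `m` is a mobility on edges which is minimal on the
edges with negative stiffness coefficient. -/
theorem le_sum_mul_stiffness_sq (hΩ : volume (frontier Ω) = 0) {c : ℝ} (hc1 : c ≤ 1)
    {T : M.cells} {f : V → ℝ}
    (hc : c * ∑ K ∈ T.1, ∑ L ∈ T.1, stiffnessPos M D T K L * (f L - f K) ^ 2 ≤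
        ∑ K ∈ T.1, ∑ L ∈ T.1, stiffness M D T K L * (f L - f K) ^ 2)
    {m : V → V → ℝ} {m₀ ε : ℝ} (hm₀ : 0 ≤ m₀) (hε : 0 ≤ ε)
    (hm : ∀ K ∈ T.1, ∀ L ∈ T.1, m₀ ≤ m K L)
    (hneg : ∀ K ∈ T.1, ∀ L ∈ T.1, stiffness M D T K L < 0 → m K L = m₀) :
    c * ∑ K ∈ T.1, ∑ L ∈ T.1, m K L * (stiffnessPos M D T K L * (f L - f K) ^ 2) +
      2 * D.Λ₀ * ε * (volume.real (M.triangle T) * ‖M.cellGrad T f‖ ^ 2) ≤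
    ∑ K ∈ T.1, ∑ L ∈ T.1, (ε + m K L) * stiffness M D T K L * (f L - f K) ^ 2 := by
  -- The excess `m - m₀` vanishes on negative edges, so only the constant part `ε + m₀` meets
  -- negative coefficients.
  have h1 : ∑ K ∈ T.1, ∑ L ∈ T.1, (ε + m K L) * stiffness M D T K L * (f L - f K) ^ 2 =
      ε * ∑ K ∈ T.1, ∑ L ∈ T.1, stiffness M D T K L * (f L - f K) ^ 2 +
      (m₀ * ∑ K ∈ T.1, ∑ L ∈ T.1, stiffness M D T K L * (f L - f K) ^ 2 +
      ∑ K ∈ T.1, ∑ L ∈ T.1, (m K L - m₀) * (stiffnessPos M D T K L * (f L - f K) ^ 2)) := by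
    simp only [Finset.mul_sum, ← Finset.sum_add_distrib]
    refine Finset.sum_congr rfl fun K hK => Finset.sum_congr rfl fun L hL => ?_
    rcases lt_or_ge (stiffness M D T K L) 0 with h | h
    · rw [hneg K hK L hL h]; ring
    · rw [stiffnessPos, max_eq_left h]; ring
  have h2 : ∑ K ∈ T.1, ∑ L ∈ T.1, m K L * (stiffnessPos M D T K L * (f L - f K) ^ 2) =
      m₀ * ∑ K ∈ T.1, ∑ L ∈ T.1, stiffnessPos M D T K L * (f L - f K) ^ 2 +
      ∑ K ∈ T.1, ∑ L ∈ T.1, (m K L - m₀) * (stiffnessPos M D T K L * (f L - f K) ^ 2) := by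
    simp only [Finset.mul_sum, ← Finset.sum_add_distrib]
    exact Finset.sum_congr rfl fun K hK => Finset.sum_congr rfl fun L hL => by ring
  have h3 : 0 ≤ ∑ K ∈ T.1, ∑ L ∈ T.1,
      (m K L - m₀) * (stiffnessPos M D T K L * (f L - f K) ^ 2) :=
    Finset.sum_nonneg fun K hK => Finset.sum_nonneg fun L hL =>
      mul_nonneg (sub_nonneg.2 (hm K hK L hL))
        (mul_nonneg (stiffnessPos_nonneg M D T K L) (sq_nonneg _))
  have h4 := mul_le_mul_of_nonneg_left hc hm₀
  have h5 := mul_le_mul_of_nonneg_left (le_sum_stiffness_sq M D hΩ T f) hε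
  have h6 := mul_le_mul_of_nonneg_right hc1 h3
  rw [h1, h2]
  linarith

end Stiffness
-- Constitutive laws and the upwinding inequality.
namespace TwoPhaseModel

variable {Ω : Set Plane} (D : TwoPhaseModel Ω)

/-! ### Mobilities -/

theorem mob_mono (α : Fin 2) : Monotone (D.mob α) := by
  have h : ∀ s, D.mob α s = D.mob α (max 0 (min 1 s)) := by
    intro s
    rcases le_total s 0 with h0 | h0
    · rw [min_eq_right (h0.trans zero_le_one), max_eq_left h0, D.mob_of_nonpos α s h0,
        D.mob_of_nonpos α 0 le_rfl]
    · rcases le_total s 1 with h1 | h1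
      · rw [min_eq_right h1, max_eq_right h0]
      · rw [min_eq_left h1, max_eq_right zero_le_one, D.mob_of_one_le α s h1]
  intro s t hst
  rw [h s, h t]
  exact D.mob_monotone α ⟨le_max_left _ _, max_le zero_le_one (min_le_left _ _)⟩
    ⟨le_max_left _ _, max_le zero_le_one (min_le_left _ _)⟩
    (max_le_max le_rfl (min_le_min le_rfl hst))

theorem mob_nonneg (α : Fin 2) (s : ℝ) : 0 ≤ D.mob α s := by
  rw [← D.mob_of_nonpos α (min s 0) (min_le_right _ _)]
  exact D.mob_mono α (min_le_left _ _)

theorem le_totalMob (s : ℝ) : D.m₀ ≤ D.totalMob s := by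
  unfold totalMob
  rcases le_total s 0 with h0 | h0
  · have h := D.le_total_mob 0 ⟨le_rfl, zero_le_one⟩
    rw [D.mob_of_one_le 1 (1 - s) (by linarith), D.mob_of_nonpos 0 s h0]
    rwa [sub_zero, D.mob_of_nonpos 0 0 le_rfl] at h
  · rcases le_total s 1 with h1 | h1
    · exact D.le_total_mob s ⟨h0, h1⟩
    · have h := D.le_total_mob 1 ⟨zero_le_one, le_rfl⟩
      rw [D.mob_of_one_le 0 s h1, D.mob_of_nonpos 1 (1 - s) (by linarith)]
      rwa [sub_self, D.mob_of_nonpos 1 0 le_rfl] at h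

theorem totalMob_pos (s : ℝ) : 0 < D.totalMob s := D.m₀_pos.trans_le (D.le_totalMob s)

theorem totalMob_continuous : Continuous D.totalMob :=
  ((D.mob_continuous 1).comp (continuous_const.sub continuous_id)).add (D.mob_continuous 0)

/-- The fractional flow of the gas phase. -/
noncomputable def fracFlow (s : ℝ) : ℝ := D.mob 0 s / D.totalMob s

theorem fracFlow_continuous : Continuous D.fracFlow :=
  (D.mob_continuous 0).div D.totalMob_continuous fun s => (D.totalMob_pos s).ne'

theorem one_sub_fracFlow (s : ℝ) : 1 - D.fracFlow s = D.mob 1 (1 - s) / D.totalMob s := by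
  rw [fracFlow, eq_div_iff (D.totalMob_pos s).ne', sub_mul, div_mul_cancel₀ _ (D.totalMob_pos s).ne',
    totalMob]
  ring

theorem fracFlow_nonneg (s : ℝ) : 0 ≤ D.fracFlow s :=
  div_nonneg (D.mob_nonneg 0 s) (D.totalMob_pos s).le

theorem fracFlow_le_one (s : ℝ) : D.fracFlow s ≤ 1 := by
  have h := D.one_sub_fracFlow s
  have : 0 ≤ D.mob 1 (1 - s) / D.totalMob s := div_nonneg (D.mob_nonneg _ _) (D.totalMob_pos s).le
  linarith

theorem fracFlow_mono : Monotone D.fracFlow := by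
  intro s t hst
  rw [fracFlow, fracFlow, div_le_div_iff₀ (D.totalMob_pos s) (D.totalMob_pos t), totalMob, totalMob]
  have h1 := D.mob_mono 0 hst
  have h2 : D.mob 1 (1 - t) ≤ D.mob 1 (1 - s) := D.mob_mono 1 (by linarith)
  nlinarith [D.mob_nonneg 0 s, D.mob_nonneg 1 (1 - t), mul_le_mul h1 h2 (D.mob_nonneg _ _)
    (D.mob_nonneg _ _)]

/-! ### Capillary pressure -/

/-- A locally finite set is countable and closed. This is the form required by the fundamental
theorem of calculus off a countable set. -/
theorem exists_countable_hasDerivAt_pc : ∃ S : Set ℝ, S.Countable ∧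
    ∃ L : ℝ, 0 ≤ L ∧ ∀ u ∉ S, HasDerivAt D.pc (deriv D.pc u) u ∧ |deriv D.pc u| ≤ L := by
  obtain ⟨S, hS, hd, L, hL⟩ := D.pc_piecewise
  have hc : S.Countable := by
    have : S = ⋃ n : ℕ, S ∩ Icc (-(n : ℝ)) n := by
      ext x
      simp only [mem_iUnion, mem_inter_iff, mem_Icc]
      refine ⟨fun hx => ?_, fun ⟨_, hx, _⟩ => hx⟩
      obtain ⟨n, hn⟩ := exists_nat_ge |x|
      exact ⟨n, hx, abs_le.1 hn⟩
    rw [this]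
    exact countable_iUnion fun n => (hS _ _).countable
  have hcl : IsOpen Sᶜ := by
    rw [isOpen_iff_mem_nhds]
    intro x hx
    have hfin : IsClosed (S ∩ Icc (x - 1) (x + 1)) := (hS _ _).isClosed
    filter_upwards [hfin.isOpen_compl.mem_nhds (fun h => hx h.1),
      Icc_mem_nhds (show x - 1 < x by linarith) (show x < x + 1 by linarith)] with y hy hy2 hyS
    exact hy ⟨hyS, hy2⟩
  refine ⟨S, hc, max L 0, le_max_right _ _, fun u hu => ⟨?_, (hL u hu).trans (le_max_left _ _)⟩⟩
  exact ((hd.differentiableOn one_ne_zero).differentiableAt (hcl.mem_nhds hu)).hasDerivAt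

theorem deriv_pc_nonneg (u : ℝ) : 0 ≤ deriv D.pc u := D.pc_strictMono.monotone.deriv_nonneg

theorem intervalIntegrable_deriv_pc (a b : ℝ) :
    IntervalIntegrable (deriv D.pc) volume a b := by
  obtain ⟨S, hS, L, hL, hd⟩ := D.exists_countable_hasDerivAt_pc
  refine (intervalIntegrable_const (c := L)).mono_fun (measurable_deriv _).aestronglyMeasurable ?_
  refine ae_restrict_of_ae ?_
  filter_upwards [compl_mem_ae_iff.2 (hS.measure_zero volume)] with u hu
  rw [Real.norm_of_nonneg hL]
  exact (hd u hu).2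

theorem integral_deriv_pc (a b : ℝ) : ∫ u in a..b, deriv D.pc u = D.pc b - D.pc a := by
  obtain ⟨S, hS, L, hL, hd⟩ := D.exists_countable_hasDerivAt_pc
  exact integral_eq_of_hasDerivAt_off_countable _ _ hS D.pc.continuous.continuousOn
    (fun u hu => (hd u hu.2).1) (D.intervalIntegrable_deriv_pc a b)

theorem intervalIntegrable_mul_deriv_pc {f : ℝ → ℝ} (hf : Continuous f) (a b : ℝ) :
    IntervalIntegrable (fun u => f u * deriv D.pc u) volume a b :=
  (D.intervalIntegrable_deriv_pc a b).continuousOn_mul hf.continuousOn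

theorem pHatW_eq (s : ℝ) : D.pHatW s = ∫ u in (0 : ℝ)..s, D.fracFlow u * deriv D.pc u := rfl

/-- The two fractional flows add up to `1`; this is why both definitions of the global pressure
agree. -/
theorem pHatG_eq (s : ℝ) : D.pHatG s = D.pc s - D.pHatW s := by
  have h : ∀ u, D.mob 1 (1 - u) / D.totalMob u * deriv D.pc u =
      deriv D.pc u - D.fracFlow u * deriv D.pc u := fun u => by
    rw [← one_sub_fracFlow]; ring
  simp only [pHatG, h]
  rw [intervalIntegral.integral_sub (D.intervalIntegrable_deriv_pc _ _)
    (D.intervalIntegrable_mul_deriv_pc D.fracFlow_continuous _ _), integral_deriv_pc, D.pc_zero,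
    sub_zero, pHatW_eq]

theorem pHatW_sub (a b : ℝ) :
    D.pHatW b - D.pHatW a = ∫ u in a..b, D.fracFlow u * deriv D.pc u := by
  rw [pHatW_eq, pHatW_eq]
  exact intervalIntegral.integral_interval_sub_left
    (D.intervalIntegrable_mul_deriv_pc D.fracFlow_continuous _ _)
    (D.intervalIntegrable_mul_deriv_pc D.fracFlow_continuous _ _)

/-- The increments of `pHatW` lie between those computed with the end values of the fractional
flow. -/
theorem pHatW_sub_bounds {a b : ℝ} (hab : a ≤ b) :
    D.fracFlow a * (D.pc b - D.pc a) ≤ D.pHatW b - D.pHatW a ∧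
      D.pHatW b - D.pHatW a ≤ D.fracFlow b * (D.pc b - D.pc a) := by
  rw [pHatW_sub, ← integral_deriv_pc, ← intervalIntegral.integral_const_mul,
    ← intervalIntegral.integral_const_mul]
  have hi := D.intervalIntegrable_mul_deriv_pc D.fracFlow_continuous a b
  have hc := D.intervalIntegrable_deriv_pc a b
  exact ⟨intervalIntegral.integral_mono_on hab (hc.const_mul _) hi fun u hu =>
      mul_le_mul_of_nonneg_right (D.fracFlow_mono hu.1) (D.deriv_pc_nonneg u),
    intervalIntegral.integral_mono_on hab hi (hc.const_mul _) fun u hu =>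
      mul_le_mul_of_nonneg_right (D.fracFlow_mono hu.2) (D.deriv_pc_nonneg u)⟩

theorem pHatW_zero : D.pHatW 0 = 0 := by rw [pHatW_eq, intervalIntegral.integral_same]

theorem abs_pHatW_le (s : ℝ) : |D.pHatW s| ≤ |D.pc s| := by
  rcases le_total 0 s with h | h
  · have h1 := D.pHatW_sub_bounds h
    have hp := D.pc_strictMono.monotone h
    rw [D.pc_zero] at hp
    rw [pHatW_zero, D.pc_zero, sub_zero, sub_zero] at h1
    rw [abs_le, abs_of_nonneg hp]
    constructor <;> nlinarith [D.fracFlow_nonneg 0, D.fracFlow_le_one s]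
  · have h1 := D.pHatW_sub_bounds h
    have hp := D.pc_strictMono.monotone h
    rw [D.pc_zero] at hp
    rw [pHatW_zero, D.pc_zero, zero_sub, zero_sub] at h1
    rw [abs_le, abs_of_nonpos hp]
    constructor <;> nlinarith [D.fracFlow_nonneg s, D.fracFlow_le_one 0]

/-- The upwinding inequality: `s` and `s'` are the upwind gas saturations for the gas phase and the
wetting phase between two vertices with phase pressures `(p, q)` and `(p', q')`. -/
theorem upwind_global_pressure_le {sK sL dp dq : ℝ} (hpc : D.pc sL - D.pc sK = dp - dq) :
    D.m₀ * (dq + (D.pHatW sL - D.pHatW sK)) ^ 2 ≤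
      D.mob 0 (if 0 ≤ dp then sL else sK) * dp ^ 2 +
      D.mob 1 (if 0 ≤ dq then 1 - sL else 1 - sK) * dq ^ 2 := by
  -- At a single saturation the energy is the total mobility times a squared mean plus a variance.
  have hconv : ∀ s, D.m₀ * (dq + D.fracFlow s * (dp - dq)) ^ 2 ≤
      D.mob 0 s * dp ^ 2 + D.mob 1 (1 - s) * dq ^ 2 := by
    intro s
    have h1 : D.mob 0 s = D.fracFlow s * D.totalMob s :=
      (div_mul_cancel₀ _ (D.totalMob_pos s).ne').symm
    have h2 : D.mob 1 (1 - s) = (1 - D.fracFlow s) * D.totalMob s := by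
      rw [one_sub_fracFlow, div_mul_cancel₀ _ (D.totalMob_pos s).ne']
    have h0 := D.fracFlow_nonneg s
    have h3 := D.fracFlow_le_one s
    have h4 : D.mob 0 s * dp ^ 2 + D.mob 1 (1 - s) * dq ^ 2 = D.totalMob s *
        ((dq + D.fracFlow s * (dp - dq)) ^ 2 +
          D.fracFlow s * (1 - D.fracFlow s) * (dp - dq) ^ 2) := by
      rw [h1, h2]; ring
    rw [h4]
    have h5 : 0 ≤ D.fracFlow s * (1 - D.fracFlow s) * (dp - dq) ^ 2 :=
      mul_nonneg (mul_nonneg h0 (sub_nonneg.2 h3)) (sq_nonneg _)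
    exact mul_le_mul (D.le_totalMob s) (by linarith) (sq_nonneg _) (D.totalMob_pos s).le
  -- the increment of the global pressure lies between two of these convex combinations
  have hbtw : ∀ x y z R : ℝ, x ≤ z → z ≤ y → D.m₀ * x ^ 2 ≤ R → D.m₀ * y ^ 2 ≤ R →
      D.m₀ * z ^ 2 ≤ R := by
    intro x y z R hx hy h1 h2
    rcases le_total 0 z with hz | hz
    · exact (mul_le_mul_of_nonneg_left (pow_le_pow_left₀ hz hy 2) D.m₀_pos.le).trans h2
    · have : z ^ 2 ≤ x ^ 2 := by nlinarith
      exact (mul_le_mul_of_nonneg_left this D.m₀_pos.le).trans h1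
  have hab : (D.fracFlow sK * (dp - dq) ≤ D.pHatW sL - D.pHatW sK ∧
      D.pHatW sL - D.pHatW sK ≤ D.fracFlow sL * (dp - dq)) := by
    rw [← hpc]
    rcases le_total sK sL with h | h
    · exact D.pHatW_sub_bounds h
    · have := D.pHatW_sub_bounds h
      constructor <;> linarith [this.1, this.2]
  have hbd : ∀ s, min 0 (dp - dq) ≤ D.fracFlow s * (dp - dq) ∧
      D.fracFlow s * (dp - dq) ≤ max 0 (dp - dq) := by
    intro s
    have h0 := D.fracFlow_nonneg s
    have h1 := D.fracFlow_le_one s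
    rcases le_total 0 (dp - dq) with h | h
    · rw [min_eq_left h, max_eq_right h]
      exact ⟨mul_nonneg h0 h, mul_le_of_le_one_left h h1⟩
    · rw [min_eq_right h, max_eq_left h]
      constructor <;> nlinarith
  have hmono : ∀ {s t s' t' : ℝ}, s ≤ t → t' ≤ s' →
      D.mob 0 s * dp ^ 2 + D.mob 1 (1 - s') * dq ^ 2 ≤
        D.mob 0 t * dp ^ 2 + D.mob 1 (1 - t') * dq ^ 2 := fun h h' =>
    add_le_add (mul_le_mul_of_nonneg_right (D.mob_mono 0 h) (sq_nonneg _))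
      (mul_le_mul_of_nonneg_right (D.mob_mono 1 (by linarith)) (sq_nonneg _))
  -- With equal signs both phases are upwinded at the same vertex, and the mean there has the larger
  -- modulus. With opposite signs, monotonicity of `pc` makes both upwind saturations the larger
  -- ones, so the energy dominates that at either end.
  by_cases hp : 0 ≤ dp <;> by_cases hq : 0 ≤ dq <;> simp only [hp, hq, if_true, if_false]
  · have h0 : 0 ≤ dq + (D.pHatW sL - D.pHatW sK) := by
      have := (hbd sK).1.trans hab.1
      rcases min_cases 0 (dp - dq) with h | h <;> linarith
    refine le_trans ?_ (hconv sL)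
    exact mul_le_mul_of_nonneg_left (pow_le_pow_left₀ h0 (by linarith [hab.2]) 2) D.m₀_pos.le
  · have hKL : sK ≤ sL := D.pc_strictMono.le_iff_le.1 (by linarith)
    exact hbtw _ _ _ _ (by linarith [hab.1]) (by linarith [hab.2])
      ((hconv sK).trans (hmono hKL le_rfl)) ((hconv sL).trans (hmono le_rfl hKL))
  · have hKL : sL ≤ sK := D.pc_strictMono.le_iff_le.1 (by linarith)
    exact hbtw _ _ _ _ (by linarith [hab.1]) (by linarith [hab.2])
      ((hconv sK).trans (hmono le_rfl hKL)) ((hconv sL).trans (hmono hKL le_rfl))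
  · have h0 : dq + (D.pHatW sL - D.pHatW sK) ≤ 0 := by
      have := hab.2.trans (hbd sL).2
      rcases max_cases 0 (dp - dq) with h | h <;> linarith
    refine le_trans ?_ (hconv sK)
    have h1 : dq + D.fracFlow sK * (dp - dq) ≤ dq + (D.pHatW sL - D.pHatW sK) := by
      linarith [hab.1]
    exact mul_le_mul_of_nonneg_left (by nlinarith) D.m₀_pos.le

/-! ### Densities -/

theorem ρ_pos (α : Fin 2) (z : ℝ) : 0 < D.ρ α z := D.ρ₀_pos.trans_le (D.ρ_bounds α z).1

theorem ρ_continuous (α : Fin 2) : Continuous (D.ρ α) := (D.ρ_contDiff α).continuous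

theorem inv_ρ_continuous (α : Fin 2) : Continuous fun z => 1 / D.ρ α z :=
  continuous_const.div (D.ρ_continuous α) fun z => (D.ρ_pos α z).ne'

theorem intervalIntegrable_inv_ρ (α : Fin 2) (a b : ℝ) :
    IntervalIntegrable (fun z => 1 / D.ρ α z) volume a b :=
  (D.inv_ρ_continuous α).intervalIntegrable a b

/-- The primitive of `1 / ρ_α` which vanishes at `0`. -/
noncomputable def potential (α : Fin 2) (p : ℝ) : ℝ := ∫ z in (0 : ℝ)..p, 1 / D.ρ α z

theorem potential_zero (α : Fin 2) : D.potential α 0 = 0 := intervalIntegral.integral_same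

theorem potential_sub (α : Fin 2) (a b : ℝ) :
    D.potential α b - D.potential α a = ∫ z in a..b, 1 / D.ρ α z :=
  intervalIntegral.integral_interval_sub_left (D.intervalIntegrable_inv_ρ α _ _)
    (D.intervalIntegrable_inv_ρ α _ _)

theorem potential_sub_bounds (α : Fin 2) {a b : ℝ} (hab : a ≤ b) :
    (b - a) / D.ρ₁ ≤ D.potential α b - D.potential α a ∧
      D.potential α b - D.potential α a ≤ (b - a) / D.ρ₀ := by
  rw [potential_sub]
  have h0 : ∀ c : ℝ, (b - a) / c = ∫ _ in a..b, 1 / c := fun c => by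
    rw [intervalIntegral.integral_const, smul_eq_mul, mul_one_div]
  rw [h0, h0]
  constructor
  · exact intervalIntegral.integral_mono_on hab intervalIntegrable_const
      (D.intervalIntegrable_inv_ρ α _ _) fun z _ =>
        one_div_le_one_div_of_le (D.ρ_pos α z) (D.ρ_bounds α z).2
  · exact intervalIntegral.integral_mono_on hab (D.intervalIntegrable_inv_ρ α _ _)
      intervalIntegrable_const fun z _ => one_div_le_one_div_of_le D.ρ₀_pos (D.ρ_bounds α z).1

theorem ρ₁_pos : 0 < D.ρ₁ := (D.ρ_pos 0 0).trans_le (D.ρ_bounds 0 0).2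

theorem potential_strictMono (α : Fin 2) : StrictMono (D.potential α) := fun a b hab => by
  have h := (D.potential_sub_bounds α hab.le).1
  have : 0 < (b - a) / D.ρ₁ := div_pos (sub_pos.2 hab) D.ρ₁_pos
  linarith

theorem potential_continuous (α : Fin 2) : Continuous (D.potential α) :=
  intervalIntegral.continuous_primitive (fun a b => D.intervalIntegrable_inv_ρ α a b) 0

theorem potential_surjective (α : Fin 2) : Function.Surjective (D.potential α) := by
  refine (D.potential_continuous α).surjective ?_ ?_
  · refine Filter.tendsto_atTop_mono' _ ?_ (Filter.tendsto_id.atTop_div_const D.ρ₁_pos)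
    filter_upwards [Filter.eventually_ge_atTop 0] with x hx
    simpa [potential_zero] using (D.potential_sub_bounds α hx).1
  · refine Filter.tendsto_atBot_mono' _ ?_ (Filter.tendsto_id.atBot_div_const D.ρ₁_pos)
    filter_upwards [Filter.eventually_le_atBot 0] with x hx
    have := (D.potential_sub_bounds α hx).1
    rw [potential_zero, zero_sub, zero_sub, neg_div] at this
    simpa using neg_le_neg this

/-- `potential` as a homeomorphism of the real line. -/
noncomputable def potentialHomeo (α : Fin 2) : ℝ ≃ₜ ℝ :=
  ((D.potential_strictMono α).orderIsoOfSurjective _ (D.potential_surjective α)).toHomeomorph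

theorem potentialHomeo_apply (α : Fin 2) (p : ℝ) : D.potentialHomeo α p = D.potential α p := rfl

theorem abs_potential_le (α : Fin 2) (p : ℝ) : |D.potential α p| ≤ |p| / D.ρ₀ := by
  rcases le_total 0 p with h | h
  · have h1 := (D.potential_sub_bounds α h).2
    have h2 := (D.potential_strictMono α).monotone h
    rw [potential_zero, sub_zero, sub_zero] at h1
    rw [potential_zero] at h2
    rwa [abs_of_nonneg h, abs_of_nonneg h2]
  · have h1 := (D.potential_sub_bounds α h).2
    have h2 := (D.potential_strictMono α).monotone h
    rw [potential_zero, zero_sub, zero_sub] at h1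
    rw [potential_zero] at h2
    rwa [abs_of_nonpos h, abs_of_nonpos h2]

/-- The reason for the integral mean of `1 / ρ_α`: testing with the potential removes the density
from the fluxes. -/
theorem meanDensity_mul_potential_sub (α : Fin 2) (a b : ℝ) :
    D.meanDensity α a b * (D.potential α b - D.potential α a) = b - a := by
  rw [meanDensity]
  split_ifs with h
  · simp [h]
  · have h1 : D.potential α b - D.potential α a ≠ 0 :=
      sub_ne_zero.2 fun h' => h ((D.potential_strictMono α).injective h').symm
    have h2 : b - a ≠ 0 := sub_ne_zero.2 (Ne.symm h)
    rw [← potential_sub]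
    field_simp

theorem meanDensity_comm (α : Fin 2) (a b : ℝ) :
    D.meanDensity α a b = D.meanDensity α b a := by
  rcases eq_or_ne a b with h | h
  · rw [h]
  · rw [meanDensity, meanDensity, if_neg h, if_neg h.symm, intervalIntegral.integral_symm,
      ← neg_sub a b]
    congr 1
    have : a - b ≠ 0 := sub_ne_zero.2 h
    field_simp

/-- Rescaling to the unit interval removes the case distinction, so positivity and continuity across
`a = b` become visible. -/
theorem meanDensity_eq (α : Fin 2) (a b : ℝ) :
    D.meanDensity α a b = (∫ t in (0 : ℝ)..1, 1 / D.ρ α (a + (b - a) * t))⁻¹ := by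
  rw [meanDensity]
  split_ifs with h
  · simp [h]
  · have h2 : b - a ≠ 0 := sub_ne_zero.2 (Ne.symm h)
    rw [intervalIntegral.integral_comp_add_mul (fun z => 1 / D.ρ α z) h2, smul_eq_mul, one_div]
    simp

theorem meanDensity_pos (α : Fin 2) (a b : ℝ) : 0 < D.meanDensity α a b := by
  rw [meanDensity_eq]
  refine inv_pos.2 (intervalIntegral.intervalIntegral_pos_of_pos_on ?_ ?_ one_pos)
  · exact ((D.inv_ρ_continuous α).comp (by fun_prop :
      Continuous fun t => a + (b - a) * t)).intervalIntegrable _ _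
  · exact fun t _ => one_div_pos.2 (D.ρ_pos α _)

theorem meanDensity_continuous (α : Fin 2) :
    Continuous fun q : ℝ × ℝ => D.meanDensity α q.1 q.2 := by
  have hpos : ∀ q : ℝ × ℝ, ∫ t in (0 : ℝ)..1, 1 / D.ρ α (q.1 + (q.2 - q.1) * t) ≠ 0 := by
    intro q h
    have := D.meanDensity_pos α q.1 q.2
    rw [meanDensity_eq, h, inv_zero] at this
    exact this.false
  simp only [meanDensity_eq]
  refine Continuous.inv₀ ?_ hpos
  refine intervalIntegral.continuous_parametric_intervalIntegral_of_continuous' ?_ 0 1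
  exact (D.inv_ρ_continuous α).comp (by fun_prop)

/-- Estimate of the accumulation term tested with the potential, for one phase. -/
theorem accumulation_phase_ge (α : Fin 2) (p q : ℝ) {s t : ℝ} (hs : 0 ≤ s) (ht : 0 ≤ t) :
    (s - t) * p - t * (D.ρ α q * D.potential α q - q) ≤
      (D.ρ α p * s - D.ρ α q * t) * D.potential α p := by
  -- Monotonicity of the density, in both orders of `a` and `b`. It is used for the pairs `(0, p)`
  -- and `(p, q)`.
  have key : ∀ a b : ℝ, b - a ≤ D.ρ α b * (D.potential α b - D.potential α a) := by
    intro a b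
    have h1 : b - a = ∫ _ in a..b, (1 : ℝ) := by simp
    rw [potential_sub, ← intervalIntegral.integral_const_mul, h1]
    rcases le_total a b with h | h
    · refine intervalIntegral.integral_mono_on h intervalIntegrable_const
        ((D.intervalIntegrable_inv_ρ α _ _).const_mul _) fun z hz => ?_
      rw [mul_one_div, le_div_iff₀ (D.ρ_pos α z), one_mul]
      exact D.ρ_monotone α hz.2
    · rw [intervalIntegral.integral_symm b a, intervalIntegral.integral_symm b a]
      refine neg_le_neg (intervalIntegral.integral_mono_on h
        ((D.intervalIntegrable_inv_ρ α _ _).const_mul _) intervalIntegrable_const fun z hz => ?_)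
      rw [mul_one_div, div_le_one (D.ρ_pos α z)]
      exact D.ρ_monotone α hz.1
  have h1 := key 0 p
  have h2 := key p q
  rw [potential_zero, sub_zero, sub_zero] at h1
  nlinarith [mul_le_mul_of_nonneg_left h1 hs, mul_le_mul_of_nonneg_left h2 ht]

end TwoPhaseModel

/-! ### Truncation -/

theorem trunc_eq (s : ℝ) : trunc s = max 0 (min s 1) := by
  unfold trunc
  split_ifs with h1 h2
  · rw [min_eq_left (by linarith), max_eq_left h1.le]
  · rw [min_eq_left h2, max_eq_right (not_lt.1 h1)]
  · rw [min_eq_right (not_le.1 h2).le, max_eq_right zero_le_one]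

theorem trunc_continuous : Continuous trunc := by
  have : trunc = fun s => max 0 (min s 1) := funext trunc_eq
  rw [this]
  fun_prop

theorem trunc_nonneg (s : ℝ) : 0 ≤ trunc s := by rw [trunc_eq]; exact le_max_left _ _

theorem trunc_of_nonpos {s : ℝ} (hs : s ≤ 0) : trunc s = 0 := by
  rw [trunc_eq, min_eq_left (by linarith), max_eq_left hs]

theorem trunc_one_sub (s : ℝ) : trunc (1 - s) = 1 - trunc s := by
  unfold trunc
  split_ifs <;> linarith

/-- For `s` outside `[0, 1]` the product is nonnegative; inside, the first factor is at least `-1`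
and the second lies in `[0, pc 1]`. -/
theorem TwoPhaseModel.trunc_sub_mul_pc_ge {Ω : Set Plane} (D : TwoPhaseModel Ω) (s : ℝ) {t : ℝ}
    (ht : 0 ≤ t ∧ t ≤ 1) : -D.pc 1 ≤ (trunc s - t) * D.pc s := by
  have h1 : D.pc 0 ≤ D.pc 1 := D.pc_strictMono.monotone zero_le_one
  rw [D.pc_zero] at h1
  unfold trunc
  split_ifs with h2 h3
  · have := D.pc_strictMono h2
    rw [D.pc_zero] at this
    nlinarith
  · have h4 := D.pc_strictMono.monotone (not_lt.1 h2)
    have h5 := D.pc_strictMono.monotone h3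
    rw [D.pc_zero] at h4
    nlinarith
  · have h5 := D.pc_strictMono.monotone (not_le.1 h3).le
    nlinarith

/-! ### The energy estimate. -/

section Energy

variable {V : Type*} [DecidableEq V] {Ω : Set Plane} {M : TriMesh V Ω} (D : TwoPhaseModel Ω)
  {ΓD : Set Plane}

theorem pc_sat (p : M.Pressures ΓD) (K : V) :
    D.pc (sat D p 0 K) = (p 0).1 K - (p 1).1 K := by
  simp [sat, TwoPhaseModel.G]

theorem sat_one (p : M.Pressures ΓD) (K : V) : sat D p 1 K = 1 - sat D p 0 K := by
  simp [sat, TwoPhaseModel.G]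

theorem pressure_of_mem (p : M.Pressures ΓD) (α : Fin 2) {K : V} (hK : M.pos K ∈ ΓD) :
    (p α).1 K = 0 := (p α).2 K hK

theorem sat_of_mem (p : M.Pressures ΓD) {K : V} (hK : M.pos K ∈ ΓD) : sat D p 0 K = 0 := by
  apply D.pc.injective
  rw [pc_sat, pressure_of_mem p 0 hK, pressure_of_mem p 1 hK, D.pc_zero, sub_zero]

theorem zeta_zero (p : M.Pressures ΓD) : zeta D p 0 = zeta D p 1 := by
  funext K
  simp only [zeta, Matrix.cons_val_zero, Matrix.cons_val_one, D.pHatG_eq, pc_sat]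
  ring

theorem zeta_one (p : M.Pressures ΓD) (K : V) :
    zeta D p 1 K = (p 1).1 K + D.pHatW (sat D p 0 K) := by
  simp [zeta]

theorem zeta_mem (p : M.Pressures ΓD) : zeta D p 1 ∈ M.dirichletSpace ΓD := fun K hK => by
  rw [zeta_one, pressure_of_mem p 1 hK, sat_of_mem D p hK, D.pHatW_zero, add_zero]

theorem inf'_le_interfaceSat (p : M.Pressures ΓD) (α : Fin 2) (T : M.cells) {K L : V}
    (hK : K ∈ T.1) (hL : L ∈ T.1) :
    T.1.inf' (M.cell_nonempty T) (sat D p α) ≤ interfaceSat D p α T K L := by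
  unfold interfaceSat
  split_ifs
  exacts [Finset.inf'_le _ hL, Finset.inf'_le _ hK, le_rfl]

/-- The upwind value can depend on the orientation of the edge only when the pressures are equal,
and then the other factor vanishes. Hence the fluxes are conservative. -/
theorem interfaceSat_mul_comm (hΩ : volume (frontier Ω) = 0) (p : M.Pressures ΓD) (α : Fin 2)
    (T : M.cells) (K L : V) (f : ℝ → ℝ) :
    f (interfaceSat D p α T L K) * ((p α).1 K - (p α).1 L) =
      -(f (interfaceSat D p α T K L) * ((p α).1 L - (p α).1 K)) := by
  rcases lt_trichotomy ((p α).1 K) ((p α).1 L) with h | h | h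
  · have h1 : 0 ≤ (p α).1 L - (p α).1 K := by linarith
    have h2 : ¬ 0 ≤ (p α).1 K - (p α).1 L := by linarith
    simp only [interfaceSat, stiffness_comm M D hΩ T L K, h1, h2, if_true, if_false]
    ring
  · rw [h, sub_self, mul_zero, mul_zero, neg_zero]
  · have h1 : ¬ 0 ≤ (p α).1 L - (p α).1 K := by linarith
    have h2 : 0 ≤ (p α).1 K - (p α).1 L := by linarith
    simp only [interfaceSat, stiffness_comm M D hΩ T L K, h1, h2, if_true, if_false]
    ring

/-- The numerical flux of the regularized scheme. -/
noncomputable def fluxReg (ε η : ℝ) (p : M.Pressures ΓD) (α : Fin 2) (T : M.cells) (K L : V) : ℝ :=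
  D.meanDensity α ((p α).1 K) ((p α).1 L) *
    (D.mobReg ε α (interfaceSat D p α T K L) * ((p α).1 L - (p α).1 K) * stiffness M D T K L +
      η * (-1) ^ (α : ℕ) * stiffnessPos M D T K L *
        (((p 0).1 L - (p 1).1 L) - ((p 0).1 K - (p 1).1 K)))

theorem stiffnessPos_comm (hΩ : volume (frontier Ω) = 0) (T : M.cells) (K L : V) :
    stiffnessPos M D T K L = stiffnessPos M D T L K := by
  rw [stiffnessPos, stiffness_comm M D hΩ, stiffnessPos]

theorem fluxReg_comm (hΩ : volume (frontier Ω) = 0) (ε η : ℝ) (p : M.Pressures ΓD) (α : Fin 2)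
    (T : M.cells) (K L : V) :
    fluxReg D ε η p α T L K = -fluxReg D ε η p α T K L := by
  rw [fluxReg, fluxReg, interfaceSat_mul_comm D hΩ p α T K L (D.mobReg ε α), D.meanDensity_comm,
    stiffness_comm M D hΩ T L K, stiffnessPos_comm D hΩ T L K]
  ring

theorem schemeReg_eq (δt : ℝ) (pn : M.Pressures ΓD) (ε η : ℝ) (p : M.Pressures ΓD) (α : Fin 2)
    (K : M.FreeVertex ΓD) : schemeReg D δt pn ε η p α K =
      accumulation D pn p α K -
        δt * ∑ T : M.cells with K.1 ∈ T.1, ∑ L ∈ T.1, fluxReg D ε η p α T K L := by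
  rw [schemeReg, sub_sub, mul_assoc, mul_assoc, ← mul_add, ← mul_assoc, Finset.mul_sum,
    ← Finset.sum_add_distrib]
  congr 2
  refine Finset.sum_congr rfl fun T hT => ?_
  rw [← Finset.add_sum_erase T.1 _ (Finset.mem_filter.1 hT).2, Finset.sum_filter, Finset.mul_sum,
    ← Finset.sum_add_distrib]
  have h0 : fluxReg D ε η p α T K K = 0 := by simp [fluxReg]
  rw [h0, zero_add]
  refine Finset.sum_congr rfl fun L _ => ?_
  rw [pc_sat, pc_sat, fluxReg]
  split_ifs with h
  · rw [stiffnessPos, max_eq_left h, abs_of_nonneg h]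
    ring
  · rw [stiffnessPos, max_eq_right (not_le.1 h).le]
    ring

theorem meanPorosity_nonneg (hΩ : volume (frontier Ω) = 0) (K : V) : 0 ≤ meanPorosity M D K := by
  refine mul_nonneg (one_div_nonneg.2 measureReal_nonneg) (integral_nonneg_of_ae ?_)
  have h := D.φ_bounds
  rw [← Measure.restrict_congr_set (closure_ae_eq_of_null_frontier hΩ)] at h
  filter_upwards [ae_restrict_of_ae_restrict_of_subset (M.controlVolume_subset K) h] with x hx
  exact D.φ₀_pos.le.trans hx.1

theorem cv_coeff_nonneg (hΩ : volume (frontier Ω) = 0) (K : V) :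
    0 ≤ M.cvMeasure K * meanPorosity M D K :=
  mul_nonneg measureReal_nonneg (meanPorosity_nonneg D hΩ K)

/-- Since the truncated saturations sum to `1`, the pressures of the two phases combine into `p_g -
p_w = pc(s_g)`. The bound depends only on the old time step. -/
theorem sum_accumulation_mul_ge (hΩ : volume (frontier Ω) = 0) (pn p : M.Pressures ΓD)
    (hpn : ∀ α K, 0 ≤ sat D pn α K ∧ sat D pn α K ≤ 1) (K : V) :
    -(M.cvMeasure K * meanPorosity M D K * (D.pc 1 + ∑ α, sat D pn α K *
      (D.ρ α ((pn α).1 K) * D.potential α ((pn α).1 K) - (pn α).1 K))) ≤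
      ∑ α, accumulation D pn p α K * D.potential α ((p α).1 K) := by
  have h0 := D.accumulation_phase_ge 0 ((p 0).1 K) ((pn 0).1 K) (trunc_nonneg (sat D p 0 K))
    (hpn 0 K).1
  have h1 := D.accumulation_phase_ge 1 ((p 1).1 K) ((pn 1).1 K) (trunc_nonneg (sat D p 1 K))
    (hpn 1 K).1
  have h2 := D.trunc_sub_mul_pc_ge (sat D p 0 K) (hpn 0 K)
  rw [pc_sat] at h2
  rw [sat_one D p, trunc_one_sub, sat_one D pn] at h1
  simp only [Fin.sum_univ_two, accumulation, sat_one D p, trunc_one_sub, sat_one D pn]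
  have h3 := mul_le_mul_of_nonneg_left (add_le_add h0 h1) (cv_coeff_nonneg (M := M) D hΩ K)
  have h4 := mul_le_mul_of_nonneg_left h2 (cv_coeff_nonneg (M := M) D hΩ K)
  linarith

variable [Fintype V]

theorem sum_sum_filter_cells (F : M.cells → V → ℝ) :
    ∑ K, ∑ T : M.cells with K ∈ T.1, F T K = ∑ T : M.cells, ∑ K ∈ T.1, F T K := by
  refine Finset.sum_comm' fun K T => ?_
  simp

/-- Discrete integration by parts. -/
theorem sum_flux_mul (X : M.cells → V → V → ℝ) (hX : ∀ T K L, X T L K = -X T K L) (h : V → ℝ) :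
    ∑ K, (∑ T : M.cells with K ∈ T.1, ∑ L ∈ T.1, X T K L) * h K =
      -(1 / 2) * ∑ T : M.cells, ∑ K ∈ T.1, ∑ L ∈ T.1, X T K L * (h L - h K) := by
  simp only [Finset.sum_mul]
  rw [sum_sum_filter_cells, Finset.mul_sum]
  refine Finset.sum_congr rfl fun T _ => ?_
  have h1 : ∑ K ∈ T.1, ∑ L ∈ T.1, X T K L * h L = -∑ K ∈ T.1, ∑ L ∈ T.1, X T K L * h K := by
    rw [Finset.sum_comm, ← Finset.sum_neg_distrib]
    refine Finset.sum_congr rfl fun K _ => ?_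
    rw [← Finset.sum_neg_distrib]
    exact Finset.sum_congr rfl fun L _ => by rw [hX, neg_mul]
  simp only [mul_sub, Finset.sum_sub_distrib, h1]
  ring

theorem sum_freeVertex [Fintype (M.FreeVertex ΓD)] (g : V → ℝ)
    (hg : ∀ K, M.pos K ∈ ΓD → g K = 0) : ∑ K : M.FreeVertex ΓD, g K = ∑ K, g K := by
  classical
  rw [← Finset.sum_subtype (Finset.univ.filter fun K => M.pos K ∉ ΓD) (by simp) g,
    Finset.sum_filter]
  refine Finset.sum_congr rfl fun K _ => ?_
  split_ifs with h
  · exact (hg K h).symm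
  · rfl

/-- Potentials vanish at Dirichlet vertices, so the sum extends to all vertices and can be
integrated by parts. The signs `(-1) ^ α` merge the two `η`-terms into one square of `p_g - p_w`. -/
theorem sum_schemeReg_mul [Fintype (M.FreeVertex ΓD)] (hΩ : volume (frontier Ω) = 0) (δt : ℝ)
    (pn : M.Pressures ΓD) (ε η : ℝ) (p : M.Pressures ΓD) :
    ∑ α, ∑ K : M.FreeVertex ΓD, schemeReg D δt pn ε η p α K * D.potential α ((p α).1 K) =
      ∑ K, ∑ α, accumulation D pn p α K * D.potential α ((p α).1 K) +
      δt / 2 * ∑ T : M.cells, (∑ α, ∑ K ∈ T.1, ∑ L ∈ T.1,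
          (ε + D.mob α (interfaceSat D p α T K L)) * stiffness M D T K L *
            ((p α).1 L - (p α).1 K) ^ 2 +
        η * ∑ K ∈ T.1, ∑ L ∈ T.1, stiffnessPos M D T K L *
          ((p 0 - p 1 : M.dirichletSpace ΓD).1 L - (p 0 - p 1 : M.dirichletSpace ΓD).1 K) ^ 2) := by
  have h1 : ∀ α, ∑ K : M.FreeVertex ΓD, schemeReg D δt pn ε η p α K * D.potential α ((p α).1 K) =
      ∑ K, accumulation D pn p α K * D.potential α ((p α).1 K) +
        δt / 2 * ∑ T : M.cells, ∑ K ∈ T.1, ∑ L ∈ T.1, fluxReg D ε η p α T K L *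
          (D.potential α ((p α).1 L) - D.potential α ((p α).1 K)) := by
    intro α
    simp only [schemeReg_eq]
    rw [sum_freeVertex (fun K => (accumulation D pn p α K -
      δt * ∑ T : M.cells with K ∈ T.1, ∑ L ∈ T.1, fluxReg D ε η p α T K L) *
        D.potential α ((p α).1 K))
      (fun K hK => by rw [pressure_of_mem p α hK, D.potential_zero, mul_zero])]
    simp only [sub_mul, Finset.sum_sub_distrib, mul_assoc, ← Finset.mul_sum]
    rw [sum_flux_mul (fun T K L => fluxReg D ε η p α T K L)
      (fun T K L => fluxReg_comm D hΩ ε η p α T K L)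
      (fun K => D.potential α ((p α).1 K))]
    ring
  simp only [h1]
  rw [Finset.sum_add_distrib, ← Finset.mul_sum, Finset.sum_comm, add_right_inj]
  congr 1
  rw [Finset.sum_comm]
  refine Finset.sum_congr rfl fun T _ => ?_
  simp only [Fin.sum_univ_two, Finset.mul_sum, ← Finset.sum_add_distrib]
  refine Finset.sum_congr rfl fun K _ => Finset.sum_congr rfl fun L _ => ?_
  have h2 : ∀ α, fluxReg D ε η p α T K L *
      (D.potential α ((p α).1 L) - D.potential α ((p α).1 K)) =
      (D.mobReg ε α (interfaceSat D p α T K L) * ((p α).1 L - (p α).1 K) * stiffness M D T K L +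
      η * (-1) ^ (α : ℕ) * stiffnessPos M D T K L *
        (((p 0).1 L - (p 1).1 L) - ((p 0).1 K - (p 1).1 K))) * ((p α).1 L - (p α).1 K) := by
    intro α
    rw [fluxReg, ← D.meanDensity_mul_potential_sub α]
    ring
  simp only [h2, TwoPhaseModel.mobReg, Submodule.coe_sub, Pi.sub_apply, Fin.val_zero, Fin.val_one,
    pow_zero, pow_one]
  ring

/-- Coercivity keeps a fraction `c` of the mobility-weighted energy of the positive edges, where the
upwinding inequality produces the global pressure. The `η`-sum already has positive coefficients, so
it loses no factor. -/
theorem cell_energy_ge (hΩ : volume (frontier Ω) = 0) {c : ℝ} (hc0 : 0 ≤ c) (hc1 : c ≤ 1)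
    {T : M.cells} (hc : ∀ f : V → ℝ,
      c * ∑ K ∈ T.1, ∑ L ∈ T.1, stiffnessPos M D T K L * (f L - f K) ^ 2 ≤
        ∑ K ∈ T.1, ∑ L ∈ T.1, stiffness M D T K L * (f L - f K) ^ 2)
    {ε η : ℝ} (hε : 0 ≤ ε) (hη : 0 ≤ η) (p : M.Pressures ΓD) :
    2 * D.Λ₀ * (c * D.m₀ * (volume.real (M.triangle T) * ‖M.cellGrad T (zeta D p 1)‖ ^ 2) +
      ε * ∑ α, volume.real (M.triangle T) * ‖M.cellGrad T (p α).1‖ ^ 2 +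
      η * (volume.real (M.triangle T) *
        ‖M.cellGrad T (p 0 - p 1 : M.dirichletSpace ΓD).1‖ ^ 2)) ≤
    ∑ α, ∑ K ∈ T.1, ∑ L ∈ T.1, (ε + D.mob α (interfaceSat D p α T K L)) * stiffness M D T K L *
            ((p α).1 L - (p α).1 K) ^ 2 +
        η * ∑ K ∈ T.1, ∑ L ∈ T.1, stiffnessPos M D T K L *
          ((p 0 - p 1 : M.dirichletSpace ΓD).1 L -
            (p 0 - p 1 : M.dirichletSpace ΓD).1 K) ^ 2 := by
  have h1 : ∀ α, _ := fun α => le_sum_mul_stiffness_sq M D hΩ hc1 (hc (p α).1)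
    (m := fun K L => D.mob α (interfaceSat D p α T K L))
    (D.mob_nonneg α (T.1.inf' (M.cell_nonempty T) (sat D p α))) hε
    (fun K hK L hL => D.mob_mono α (inf'_le_interfaceSat D p α T hK hL))
    (fun K _ L _ h => by rw [interfaceSat, if_neg (not_le.2 h)])
  have hle : ∀ f : V → ℝ, ∑ K ∈ T.1, ∑ L ∈ T.1, stiffness M D T K L * (f L - f K) ^ 2 ≤
      ∑ K ∈ T.1, ∑ L ∈ T.1, stiffnessPos M D T K L * (f L - f K) ^ 2 := fun f =>
    Finset.sum_le_sum fun K _ => Finset.sum_le_sum fun L _ =>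
      mul_le_mul_of_nonneg_right (stiffness_le_stiffnessPos M D T K L) (sq_nonneg _)
  have h2 : D.m₀ * ∑ K ∈ T.1, ∑ L ∈ T.1,
      stiffnessPos M D T K L * (zeta D p 1 L - zeta D p 1 K) ^ 2 ≤
      ∑ α, ∑ K ∈ T.1, ∑ L ∈ T.1, D.mob α (interfaceSat D p α T K L) *
        (stiffnessPos M D T K L * ((p α).1 L - (p α).1 K) ^ 2) := by
    simp only [Fin.sum_univ_two, Finset.mul_sum, ← Finset.sum_add_distrib]
    refine Finset.sum_le_sum fun K _ => Finset.sum_le_sum fun L _ => ?_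
    rcases lt_or_ge (stiffness M D T K L) 0 with h | h
    · simp [stiffnessPos, max_eq_right h.le]
    · have h3 := D.upwind_global_pressure_le (sK := sat D p 0 K) (sL := sat D p 0 L)
        (dp := (p 0).1 L - (p 0).1 K) (dq := (p 1).1 L - (p 1).1 K)
        (by rw [pc_sat, pc_sat]; ring)
      have h4 := mul_le_mul_of_nonneg_left h3 (stiffnessPos_nonneg M D T K L)
      have h5 : zeta D p 1 L - zeta D p 1 K = (p 1).1 L - (p 1).1 K +
          (D.pHatW (sat D p 0 L) - D.pHatW (sat D p 0 K)) := by
        rw [zeta_one, zeta_one]; ring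
      simp only [interfaceSat, h, if_true, sat_one D p, h5]
      linarith
  have h3 := le_sum_stiffness_sq M D hΩ T (zeta D p 1)
  have h4 := (le_sum_stiffness_sq M D hΩ T (p 0 - p 1 : M.dirichletSpace ΓD).1).trans (hle _)
  have h5 := mul_le_mul_of_nonneg_left h4 hη
  have h6 := mul_le_mul_of_nonneg_left ((mul_le_mul_of_nonneg_left (h3.trans (hle _))
    D.m₀_pos.le).trans h2) hc0
  have h7 := add_le_add (h1 0) (h1 1)
  simp only [Fin.sum_univ_two] at h6 ⊢
  linarith

/-- The energy estimate. -/
theorem exists_energy_estimate [Fintype (M.FreeVertex ΓD)] (hΩ : volume (frontier Ω) = 0)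
    {δt : ℝ} (hδt : 0 < δt) (pn : M.Pressures ΓD)
    (hpn : ∀ α K, 0 ≤ sat D pn α K ∧ sat D pn α K ≤ 1) :
    ∃ c C : ℝ, 0 < c ∧ ∀ ε η : ℝ, 0 ≤ ε → 0 ≤ η → ∀ p : M.Pressures ΓD,
      c * (M.gradNorm (zeta D p 1) ^ 2 + ε * ∑ α, M.gradNorm (p α).1 ^ 2 +
        η * M.gradNorm (p 0 - p 1 : M.dirichletSpace ΓD).1 ^ 2) - C ≤
      ∑ α, ∑ K : M.FreeVertex ΓD, schemeReg D δt pn ε η p α K * D.potential α ((p α).1 K) := by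
  obtain ⟨c, hc0, hc1, hc⟩ := exists_stiffnessPos_le M D hΩ
  have hcm : 0 < c * D.m₀ := mul_pos hc0 D.m₀_pos
  refine ⟨δt * D.Λ₀ * min (c * D.m₀) 1, ∑ K, M.cvMeasure K * meanPorosity M D K *
    (D.pc 1 + ∑ α, sat D pn α K *
      (D.ρ α ((pn α).1 K) * D.potential α ((pn α).1 K) - (pn α).1 K)), mul_pos (mul_pos hδt D.Λ₀_pos) (by positivity),
    fun ε η hε hη p => ?_⟩
  rw [sum_schemeReg_mul D hΩ]
  have h1 := Finset.sum_le_sum fun K (_ : K ∈ Finset.univ) =>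
    sum_accumulation_mul_ge D hΩ pn p hpn K
  have h2 := Finset.sum_le_sum fun T (_ : T ∈ Finset.univ) =>
    cell_energy_ge D hΩ hc0.le hc1 (hc T) hε hη p
  rw [Finset.sum_neg_distrib] at h1
  have hsum : ∑ T : M.cells, 2 * D.Λ₀ * (c * D.m₀ *
      (volume.real (M.triangle T) * ‖M.cellGrad T (zeta D p 1)‖ ^ 2) +
      ε * ∑ α, volume.real (M.triangle T) * ‖M.cellGrad T (p α).1‖ ^ 2 +
      η * (volume.real (M.triangle T) *
        ‖M.cellGrad T (p 0 - p 1 : M.dirichletSpace ΓD).1‖ ^ 2)) =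
      2 * D.Λ₀ * (c * D.m₀ * M.gradNorm (zeta D p 1) ^ 2 + ε * ∑ α, M.gradNorm (p α).1 ^ 2 +
        η * M.gradNorm (p 0 - p 1 : M.dirichletSpace ΓD).1 ^ 2) := by
    simp only [M.gradNorm_sq, Fin.sum_univ_two, Finset.mul_sum, mul_add, Finset.sum_add_distrib]
  rw [hsum] at h2
  have h3 := mul_le_mul_of_nonneg_left h2 (half_pos hδt).le
  set A := M.gradNorm (zeta D p 1) ^ 2
  set B := ∑ α, M.gradNorm (p α).1 ^ 2
  set E := M.gradNorm (p 0 - p 1 : M.dirichletSpace ΓD).1 ^ 2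
  have hA : 0 ≤ A := sq_nonneg _
  have hB : 0 ≤ B := Finset.sum_nonneg fun α _ => sq_nonneg _
  have hE : 0 ≤ E := sq_nonneg _
  have h4 : min (c * D.m₀) 1 * (A + ε * B + η * E) ≤ c * D.m₀ * A + ε * B + η * E := by
    have e1 := mul_le_mul_of_nonneg_right (min_le_left (c * D.m₀) 1) hA
    have e2 := mul_le_mul_of_nonneg_right (min_le_right (c * D.m₀) 1)
      (add_nonneg (mul_nonneg hε hB) (mul_nonneg hη hE))
    linarith
  have h5 := mul_le_mul_of_nonneg_left h4 (mul_pos hδt D.Λ₀_pos).le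
  refine le_trans ?_ (add_le_add h1 h3)
  rw [sub_eq_add_neg, add_comm]
  refine add_le_add le_rfl ?_
  linarith

end Energy
-- Continuity of the scheme and the maximum principle.
section Regularized

variable {V : Type*} [DecidableEq V] {Ω : Set Plane} {M : TriMesh V Ω} (D : TwoPhaseModel Ω)
  {ΓD : Set Plane}

theorem continuous_pressure (α : Fin 2) (K : V) :
    Continuous fun p : M.Pressures ΓD => (p α).1 K :=
  (continuous_apply K).comp (continuous_subtype_val.comp (continuous_apply α))

theorem continuous_sat (α : Fin 2) (K : V) : Continuous fun p : M.Pressures ΓD => sat D p α K := by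
  have h0 : Continuous fun p : M.Pressures ΓD => sat D p 0 K := by
    simp only [sat, TwoPhaseModel.G, Matrix.cons_val_zero]
    exact D.pc.symm.continuous.comp ((continuous_pressure 0 K).sub (continuous_pressure 1 K))
  fin_cases α
  · exact h0
  · simp only [Fin.mk_one, sat_one]
    exact continuous_const.sub h0

theorem continuous_accumulation (pn : M.Pressures ΓD) (α : Fin 2) (K : V) :
    Continuous fun p => accumulation D pn p α K :=
  continuous_const.mul ((((D.ρ_continuous α).comp (continuous_pressure α K)).mul
    (trunc_continuous.comp (continuous_sat D α K))).sub continuous_const)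

/-- The upwind saturation jumps only where the pressure difference vanishes; splitting that
difference into positive and negative parts makes the product continuous. -/
theorem continuous_fluxReg (α : Fin 2) (T : M.cells) (K L : V) :
    Continuous fun q : ℝ × ℝ × M.Pressures ΓD => fluxReg D q.1 q.2.1 q.2.2 α T K L := by
  have hp : ∀ β J, Continuous fun q : ℝ × ℝ × M.Pressures ΓD => (q.2.2 β).1 J := fun β J =>
    (continuous_pressure β J).comp (by fun_prop)
  have hs : ∀ J, Continuous fun q : ℝ × ℝ × M.Pressures ΓD => sat D q.2.2 α J := fun J =>
    (continuous_sat D α J).comp (by fun_prop)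
  have hup : Continuous fun q : ℝ × ℝ × M.Pressures ΓD =>
      D.mobReg q.1 α (interfaceSat D q.2.2 α T K L) * ((q.2.2 α).1 L - (q.2.2 α).1 K) := by
    simp only [TwoPhaseModel.mobReg]
    by_cases hst : 0 ≤ stiffness M D T K L
    · have heq : ∀ q : ℝ × ℝ × M.Pressures ΓD,
          (q.1 + D.mob α (interfaceSat D q.2.2 α T K L)) * ((q.2.2 α).1 L - (q.2.2 α).1 K) =
          (q.1 + D.mob α (sat D q.2.2 α L)) * max ((q.2.2 α).1 L - (q.2.2 α).1 K) 0 +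
          (q.1 + D.mob α (sat D q.2.2 α K)) * min ((q.2.2 α).1 L - (q.2.2 α).1 K) 0 := by
        intro q
        rw [interfaceSat, if_pos hst]
        split_ifs with h
        · rw [max_eq_left h, min_eq_right h, mul_zero, add_zero]
        · rw [max_eq_right (not_le.1 h).le, min_eq_left (not_le.1 h).le, mul_zero, zero_add]
      simp only [heq]
      exact ((continuous_fst.add ((D.mob_continuous α).comp (hs L))).mul
        (((hp α L).sub (hp α K)).max continuous_const)).add
        ((continuous_fst.add ((D.mob_continuous α).comp (hs K))).mul
        (((hp α L).sub (hp α K)).min continuous_const))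
    · simp only [interfaceSat, if_neg hst]
      exact (continuous_fst.add ((D.mob_continuous α).comp
        (Continuous.finset_inf'_apply _ fun J _ => hs J))).mul ((hp α L).sub (hp α K))
  unfold fluxReg
  refine Continuous.mul ((D.meanDensity_continuous α).comp ((hp α K).prodMk (hp α L))) ?_
  refine (hup.mul continuous_const).add (Continuous.mul ?_
    (((hp 0 L).sub (hp 1 L)).sub ((hp 0 K).sub (hp 1 K))))
  fun_prop

/-- Continuity of the regularized scheme in the parameters and the unknown. -/
theorem continuous_schemeReg (δt : ℝ) (pn : M.Pressures ΓD) :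
    Continuous fun q : ℝ × ℝ × M.Pressures ΓD => schemeReg D δt pn q.1 q.2.1 q.2.2 := by
  refine continuous_pi fun α => continuous_pi fun K => ?_
  simp only [schemeReg_eq]
  refine ((continuous_accumulation D pn α K).comp (by fun_prop)).sub (continuous_const.mul ?_)
  exact continuous_finsetSum _ fun T _ => continuous_finsetSum _ fun L _ =>
    continuous_fluxReg D α T K L

/-- Consistency of the regularized scheme. -/
theorem schemeReg_zero (δt : ℝ) (pn : M.Pressures ΓD) :
    schemeReg D δt pn 0 0 = scheme D δt pn := by
  funext p α K
  simp [schemeReg, scheme, TwoPhaseModel.mobReg]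

/-- A graph on three vertices without isolated vertex is connected. Otherwise `K` and a neighbour in
`A`, with `L` and a neighbour outside `A`, would be four vertices of one triangle. -/
theorem stiffness_propagation (hΩ : volume (frontier Ω) = 0) {A : Set V} (T : M.cells)
    (hA : ∀ K ∈ T.1, K ∈ A → ∀ L ∈ T.1, 0 < stiffness M D T K L → L ∈ A) {K : V} (hK : K ∈ T.1)
    (hKA : K ∈ A) {L : V} (hL : L ∈ T.1) : L ∈ A := by
  by_contra hLA
  have hex : ∀ J ∈ T.1, ∃ I ∈ T.1, I ≠ J ∧ 0 < stiffness M D T J I := by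
    intro J hJ
    obtain ⟨I, hI, hpos⟩ := Finset.exists_lt_of_sum_lt
      (show ∑ I ∈ T.1.erase J, (0 : ℝ) < _ by
        simpa using sum_stiffness_erase_pos M D hΩ T hJ)
    exact ⟨I, Finset.mem_of_mem_erase hI, Finset.ne_of_mem_erase hI, hpos⟩
  obtain ⟨J, hJ, hJL, hJpos⟩ := hex L hL
  have hJA : J ∉ A := fun h => hLA (hA J hJ h L hL (by rwa [stiffness_comm M D hΩ]))
  obtain ⟨I, hI, hIK, hIpos⟩ := hex K hK
  have hIA := hA K hK hKA I hI hIpos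
  have hne : ∀ {a b : V}, a ∈ A → b ∉ A → a ≠ b := fun ha hb h => hb (h ▸ ha)
  have hcard : ({I, K, J, L} : Finset V).card = 4 := by
    rw [Finset.card_insert_of_notMem, Finset.card_insert_of_notMem, Finset.card_pair hJL]
    · simp [hne hKA hJA, hne hKA hLA]
    · simp [hIK, hne hIA hJA, hne hIA hLA]
  have hsub : ({I, K, J, L} : Finset V) ⊆ T.1 := by
    intro x hx
    simp only [Finset.mem_insert, Finset.mem_singleton] at hx
    rcases hx with rfl | rfl | rfl | rfl <;> assumption
  have := Finset.card_le_card hsub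
  rw [hcard, M.card_cell T.1 T.2] at this
  omega

/-- The diffusion and capillary fluxes at a vertex where the saturation is negative and minimal. -/
theorem le_fluxReg_of_isMin {η : ℝ} {p : M.Pressures ΓD} {α : Fin 2} {T : M.cells} {K L : V}
    (hK : K ∈ T.1) (hneg : sat D p α K < 0) :
    D.meanDensity α ((p α).1 K) ((p α).1 L) * (η * stiffnessPos M D T K L *
      ((-1) ^ (α : ℕ) * (D.pc (sat D p 0 L) - D.pc (sat D p 0 K)))) ≤
      fluxReg D 0 η p α T K L := by
  rw [fluxReg, ← pc_sat, ← pc_sat]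
  refine mul_le_mul_of_nonneg_left ?_ (D.meanDensity_pos α _ _).le
  -- The mobility vanishes unless the upwind vertex is `L`, and then both the stiffness coefficient
  -- and the pressure difference are nonnegative.
  have h : 0 ≤ D.mobReg 0 α (interfaceSat D p α T K L) * ((p α).1 L - (p α).1 K) *
      stiffness M D T K L := by
    rw [TwoPhaseModel.mobReg, zero_add]
    unfold interfaceSat
    split_ifs with h1 h2
    · exact mul_nonneg (mul_nonneg (D.mob_nonneg α _) h2) h1
    · rw [D.mob_of_nonpos α _ hneg.le, zero_mul, zero_mul]
    · rw [D.mob_of_nonpos α _ ((Finset.inf'_le _ hK).trans hneg.le), zero_mul, zero_mul]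
  linarith

/-- The sign `(-1) ^ α` compensates for `s_w = 1 - s_g`, so the capillary term is increasing in the
saturation of either phase. -/
theorem sign_mul_pc_sub_nonneg {p : M.Pressures ΓD} {α : Fin 2} {K L : V}
    (h : sat D p α K ≤ sat D p α L) :
    0 ≤ (-1) ^ (α : ℕ) * (D.pc (sat D p 0 L) - D.pc (sat D p 0 K)) ∧
      ((-1) ^ (α : ℕ) * (D.pc (sat D p 0 L) - D.pc (sat D p 0 K)) = 0 →
        sat D p α L = sat D p α K) := by
  have hinj : D.pc (sat D p 0 L) - D.pc (sat D p 0 K) = 0 → sat D p 0 L = sat D p 0 K :=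
    fun h => D.pc.injective (sub_eq_zero.1 h)
  fin_cases α
  · have := D.pc_strictMono.monotone h
    simp only [Fin.zero_eta, pow_zero, one_mul] at *
    exact ⟨by linarith, hinj⟩
  · simp only [Fin.mk_one, pow_one, sat_one] at *
    have := D.pc_strictMono.monotone (show sat D p 0 L ≤ sat D p 0 K by linarith)
    exact ⟨by linarith, fun h => by rw [hinj (by linarith)]⟩

/-- The maximum principle. -/
theorem sat_nonneg_of_schemeReg_eq_zero [Fintype V] (hΩc : IsConnected Ω)
    (hΩ : volume (frontier Ω) = 0) (hM : ∃ K, M.pos K ∈ ΓD) {δt : ℝ} (hδt : 0 < δt)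
    {pn : M.Pressures ΓD} (hpn : ∀ α K, 0 ≤ sat D pn α K ∧ sat D pn α K ≤ 1) {η : ℝ} (hη : 0 < η)
    {p : M.Pressures ΓD} (hp : schemeReg D δt pn 0 η p = 0) (α : Fin 2) (K : V) :
    0 ≤ sat D p α K := by
  obtain ⟨KD, hKD⟩ := hM
  have hDir : ∀ K, M.pos K ∈ ΓD → 0 ≤ sat D p α K := by
    intro K hK
    have h0 := sat_of_mem D p hK
    fin_cases α
    · exact h0.ge
    · simp [sat_one, h0]
  have : Nonempty V := ⟨KD⟩
  obtain ⟨K₀, hK₀⟩ := Finite.exists_min (sat D p α)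
  by_contra! hneg
  have hneg₀ : sat D p α K₀ < 0 := (hK₀ K).trans_lt hneg
  have hall := M.mem_of_propagation hΩc (A := {K | sat D p α K = sat D p α K₀}) ⟨K₀, rfl⟩ ?_ KD
  · exact (hDir KD hKD).not_gt (hall.trans_lt hneg₀)
  intro T J hJ hJA I hI
  refine stiffness_propagation D hΩ T ?_ hJ hJA hI
  clear hJ hJA hI I J
  intro K hK hKA L hL hpos
  have hKmin : ∀ J, sat D p α K ≤ sat D p α J := fun J => (le_of_eq hKA).trans (hK₀ J)
  have hKneg : sat D p α K < 0 := (le_of_eq hKA).trans_lt hneg₀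
  have hKfree : M.pos K ∉ ΓD := fun h => (hDir K h).not_gt hKneg
  have heq : schemeReg D δt pn 0 η p α ⟨K, hKfree⟩ = 0 := by rw [hp]; rfl
  rw [schemeReg_eq] at heq
  have hacc : accumulation D pn p α K ≤ 0 := by
    rw [accumulation, trunc_of_nonpos hKneg.le, mul_zero, zero_sub]
    exact mul_nonpos_of_nonneg_of_nonpos (cv_coeff_nonneg D hΩ K)
      (neg_nonpos.2 (mul_nonneg (D.ρ_pos α _).le (hpn α K).1))
  have hcap : ∀ (S : M.cells) (J : V), 0 ≤ D.meanDensity α ((p α).1 K) ((p α).1 J) *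
      (η * stiffnessPos M D S K J *
        ((-1) ^ (α : ℕ) * (D.pc (sat D p 0 J) - D.pc (sat D p 0 K)))) := fun S J =>
    mul_nonneg (D.meanDensity_pos α _ _).le (mul_nonneg (mul_nonneg hη.le
      (stiffnessPos_nonneg M D S K J)) (sign_mul_pc_sub_nonneg D (hKmin J)).1)
  have hflux : ∀ S ∈ Finset.univ.filter (fun S : M.cells => K ∈ S.1), ∀ J ∈ S.1,
      0 ≤ fluxReg D 0 η p α S K J := fun S hS J _ =>
    (hcap S J).trans (le_fluxReg_of_isMin D (Finset.mem_filter.1 hS).2 hKneg)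
  have hTK : T ∈ Finset.univ.filter (fun S : M.cells => K ∈ S.1) := by simpa using hK
  have h1 := Finset.single_le_sum (fun S hS => Finset.sum_nonneg (hflux S hS)) hTK
  have h2 := Finset.single_le_sum (hflux T hTK) hL
  -- The equation equates a nonpositive accumulation with `δt` times a sum of nonnegative fluxes, so
  -- no flux can be positive.
  have h3 : fluxReg D 0 η p α T K L ≤ 0 := by
    have h4 := h2.trans h1
    simp only at heq h4
    by_contra! h5
    have := mul_pos hδt (h5.trans_le h4)
    linarith
  have h4 := le_antisymm ((le_fluxReg_of_isMin D hK hKneg).trans h3) (hcap T L)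
  have hsp : 0 < stiffnessPos M D T K L := lt_max_of_lt_left hpos
  have h5 := (mul_eq_zero.1 ((mul_eq_zero.1 h4).resolve_left
    (D.meanDensity_pos α _ _).ne')).resolve_left (mul_pos hη hsp).ne'
  exact ((sign_mul_pc_sub_nonneg D (hKmin L)).2 h5).trans hKA

theorem sat_mem_of_schemeReg_eq_zero [Fintype V] (hΩc : IsConnected Ω)
    (hΩ : volume (frontier Ω) = 0) (hM : ∃ K, M.pos K ∈ ΓD) {δt : ℝ} (hδt : 0 < δt)
    {pn : M.Pressures ΓD} (hpn : ∀ α K, 0 ≤ sat D pn α K ∧ sat D pn α K ≤ 1) {η : ℝ} (hη : 0 < η)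
    {p : M.Pressures ΓD} (hp : schemeReg D δt pn 0 η p = 0) (α : Fin 2) (K : V) :
    0 ≤ sat D p α K ∧ sat D p α K ≤ 1 := by
  have h0 := sat_nonneg_of_schemeReg_eq_zero D hΩc hΩ hM hδt hpn hη hp 0 K
  have h1 := sat_nonneg_of_schemeReg_eq_zero D hΩc hΩ hM hδt hpn hη hp 1 K
  rw [sat_one] at h1
  fin_cases α
  · exact ⟨h0, by simpa using h1⟩
  · simp only [Fin.mk_one, sat_one]
    exact ⟨h1, by linarith⟩

end Regularized
-- Existence: a zero for `ε > 0`, then the limits `ε → 0` and `η → 0`.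
theorem exists_zero_of_forall_pos {X Y : Type*} [TopologicalSpace X] [FirstCountableTopology X]
    [TopologicalSpace Y] [T2Space Y] {F : ℝ → X → Y} (hF : Continuous fun q : ℝ × X => F q.1 q.2)
    {S : Set X} (hS : IsCompact S) (y : Y) (h : ∀ t > 0, ∃ x ∈ S, F t x = y) :
    ∃ x ∈ S, F 0 x = y := by
  choose x hxS hx using fun n : ℕ => h (1 / ((n : ℝ) + 1)) Nat.one_div_pos_of_nat
  obtain ⟨a, haS, φ, hφ, hlim⟩ := hS.tendsto_subseq hxS
  refine ⟨a, haS, ?_⟩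
  have ht : Filter.Tendsto (fun n => 1 / ((φ n : ℝ) + 1)) Filter.atTop (nhds 0) :=
    tendsto_one_div_add_atTop_nhds_zero_nat.comp hφ.tendsto_atTop
  have hFlim := (hF.tendsto (0, a)).comp (ht.prodMk_nhds hlim)
  refine tendsto_nhds_unique hFlim ((Filter.tendsto_congr fun n => ?_).2 tendsto_const_nhds)
  exact hx (φ n)

section Existence

variable {V : Type*} [DecidableEq V] {Ω : Set Plane} {M : TriMesh V Ω} (D : TwoPhaseModel Ω)
  {ΓD : Set Plane}

/-- The pressures with given potentials at the free vertices. -/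
noncomputable def pressuresOfPotential (M : TriMesh V Ω) (ΓD : Set Plane)
    (x : EuclideanSpace ℝ (Fin 2 × M.FreeVertex ΓD)) : M.Pressures ΓD :=
  open Classical in fun α =>
    ⟨fun K => if h : M.pos K ∈ ΓD then 0 else (D.potentialHomeo α).symm (x (α, ⟨K, h⟩)),
      fun _ hK => dif_pos hK⟩

theorem potential_pressuresOfPotential (x : EuclideanSpace ℝ (Fin 2 × M.FreeVertex ΓD))
    (α : Fin 2) (K : M.FreeVertex ΓD) :
    D.potential α ((pressuresOfPotential D M ΓD x α).1 K) = x (α, K) := by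
  simp only [pressuresOfPotential, dif_neg K.2, ← D.potentialHomeo_apply,
    Homeomorph.apply_symm_apply]

theorem continuous_pressuresOfPotential : Continuous (pressuresOfPotential D M ΓD) := by
  refine continuous_pi fun α => Continuous.subtype_mk (continuous_pi fun K => ?_) _
  by_cases h : M.pos K ∈ ΓD
  · simp only [h, dif_pos]
    exact continuous_const
  · simp only [h, dif_neg, not_false_eq_true]
    exact (D.potentialHomeo α).symm.continuous.comp (by fun_prop)

variable [Fintype V]

theorem gradNorm_sub_perm {σ₁ σ₂ : Equiv.Perm (Fin 2)} (hσ : ∀ i, σ₁ i ≠ σ₂ i)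
    (p : M.Pressures ΓD) (i : Fin 2) :
    M.gradNorm (p (σ₁ i) - p (σ₂ i) : M.dirichletSpace ΓD).1 =
      M.gradNorm (p 0 - p 1 : M.dirichletSpace ΓD).1 := by
  have h : ∀ a b : Fin 2, a ≠ b → a = 0 ∧ b = 1 ∨ a = 1 ∧ b = 0 := by decide
  rcases h _ _ (hσ i) with ⟨h1, h2⟩ | ⟨h1, h2⟩
  · rw [h1, h2]
  · rw [h1, h2, ← M.gradNorm_neg, ← Submodule.coe_neg, neg_sub]

/-- Energy bound for the solutions of the regularized scheme. -/
theorem exists_energy_bound (hΩ : volume (frontier Ω) = 0)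
    {δt : ℝ} (hδt : 0 < δt) (pn : M.Pressures ΓD)
    (hpn : ∀ α K, 0 ≤ sat D pn α K ∧ sat D pn α K ≤ 1) :
    ∃ C : ℝ, ∀ ε η : ℝ, 0 ≤ ε → 0 ≤ η → ∀ p : M.Pressures ΓD, schemeReg D δt pn ε η p = 0 →
      M.gradNorm (zeta D p 1) ^ 2 + ε * ∑ α, M.gradNorm (p α).1 ^ 2 +
        η * M.gradNorm (p 0 - p 1 : M.dirichletSpace ΓD).1 ^ 2 ≤ C := by
  classical
  obtain ⟨c, C, hc, h⟩ := exists_energy_estimate D hΩ hδt pn hpn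
  refine ⟨C / c, fun ε η hε hη p hp => ?_⟩
  have h1 := h ε η hε hη p
  rw [hp] at h1
  simp only [Pi.zero_apply, zero_mul, Finset.sum_const_zero] at h1
  rw [le_div_iff₀ hc]
  linarith

theorem isRegularizedScheme (hΩc : IsConnected Ω) (hΩ : volume (frontier Ω) = 0)
    (hM : ∃ K, M.pos K ∈ ΓD) {δt : ℝ} (hδt : 0 < δt) (pn : M.Pressures ΓD)
    (hpn : ∀ α K, 0 ≤ sat D pn α K ∧ sat D pn α K ≤ 1)
    {σ₁ σ₂ : Equiv.Perm (Fin 2)} (hσ : ∀ i, σ₁ i ≠ σ₂ i) :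
    IsRegularizedScheme (M.dirichletSpace ΓD) M.gradNorm (sat D) (zeta D) 0 1 σ₁ σ₂
      (scheme D δt pn) (schemeReg D δt pn) := by
  obtain ⟨C, hC⟩ := exists_energy_bound D hΩ hδt pn hpn
  refine ⟨(continuous_schemeReg D δt pn).continuousOn, schemeReg_zero D δt pn,
    fun η hη p hp => sat_mem_of_schemeReg_eq_zero D hΩc hΩ hM hδt hpn hη hp,
    -- The factor `2` appears because both copies of `ζ` coincide and both permuted differences have
    -- the same norm.
    fun η hη => ⟨2 * C, fun ε hε p hp => ?_⟩, 2 * C, fun η hη p hp => ?_⟩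
  · have h := hC ε η hε.le hη.le p hp
    have hB : 0 ≤ ε * ∑ α, M.gradNorm (p α).1 ^ 2 :=
      mul_nonneg hε.le (Finset.sum_nonneg fun α _ => sq_nonneg _)
    simp only [gradNorm_sub_perm hσ]
    simp only [Fin.sum_univ_two, zeta_zero] at h hB ⊢
    linarith
  · have h := hC 0 η le_rfl hη.le p hp
    have hE : 0 ≤ η * M.gradNorm (p 0 - p 1 : M.dirichletSpace ΓD).1 ^ 2 :=
      mul_nonneg hη.le (sq_nonneg _)
    simp only [Fin.sum_univ_two, zeta_zero] at h ⊢
    linarith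

/-- Existence of a solution of the regularized scheme. -/
theorem exists_schemeReg_eq_zero (hΩc : IsConnected Ω) (hΩ : volume (frontier Ω) = 0)
    (hM : ∃ K, M.pos K ∈ ΓD) {δt : ℝ} (hδt : 0 < δt) (pn : M.Pressures ΓD)
    (hpn : ∀ α K, 0 ≤ sat D pn α K ∧ sat D pn α K ≤ 1) {ε η : ℝ} (hε : 0 < ε) (hη : 0 ≤ η) :
    ∃ p : M.Pressures ΓD, schemeReg D δt pn ε η p = 0 := by
  classical
  obtain ⟨c, C, hc, hen⟩ := exists_energy_estimate D hΩ hδt pn hpn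
  obtain ⟨a, ha, hpoin⟩ := M.exists_abs_le_gradNorm hΩc hM
  let P := pressuresOfPotential D M ΓD
  -- In potential coordinates `⟨G x, x⟩` is exactly the tested scheme of the energy estimate.
  let G : EuclideanSpace ℝ (Fin 2 × M.FreeVertex ΓD) →
      EuclideanSpace ℝ (Fin 2 × M.FreeVertex ΓD) :=
    fun x => WithLp.toLp 2 fun q => schemeReg D δt pn ε η (P x) q.1 q.2
  have hGc : Continuous G := by
    refine (PiLp.continuous_toLp 2 _).comp (continuous_pi fun q => ?_)
    exact (continuous_apply q.2).comp ((continuous_apply q.1).comp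
      ((continuous_schemeReg D δt pn).comp (continuous_const.prodMk
        (continuous_const.prodMk (continuous_pressuresOfPotential D)))))
  have hinner : ∀ x, inner ℝ (G x) x = ∑ α, ∑ K : M.FreeVertex ΓD,
      schemeReg D δt pn ε η (P x) α K * D.potential α ((P x α).1 K) := by
    intro x
    simp only [P, potential_pressuresOfPotential]
    rw [PiLp.inner_apply, Fintype.sum_prod_type]
    simp [G, P, mul_comm]
  set b : ℝ := (Fintype.card (M.FreeVertex ΓD) + 1) * (a / D.ρ₀) ^ 2 with hb
  have hb0 : 0 < b := by
    have := D.ρ₀_pos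
    positivity
  have hnorm : ∀ x, ‖x‖ ^ 2 ≤ b * ∑ α, M.gradNorm (P x α).1 ^ 2 := by
    intro x
    rw [EuclideanSpace.real_norm_sq_eq, Fintype.sum_prod_type, Finset.mul_sum]
    refine Finset.sum_le_sum fun α _ => ?_
    have hx : ∀ K : M.FreeVertex ΓD, x (α, K) ^ 2 ≤
        (a / D.ρ₀) ^ 2 * M.gradNorm (P x α).1 ^ 2 := by
      intro K
      have h1 := D.abs_potential_le α ((P x α).1 K)
      rw [potential_pressuresOfPotential] at h1
      have h2 := div_le_div_of_nonneg_right (hpoin _ (P x α).2 K) D.ρ₀_pos.le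
      rw [← sq_abs, ← mul_pow]
      refine pow_le_pow_left₀ (abs_nonneg _) ((h1.trans h2).trans (le_of_eq ?_)) 2
      ring
    refine (Finset.sum_le_sum fun K _ => hx K).trans ?_
    rw [Finset.sum_const, Finset.card_univ, nsmul_eq_mul, hb, mul_assoc]
    exact mul_le_mul_of_nonneg_right (by linarith) (by positivity)
  -- On this sphere the `ε`-term of the energy is at least `|C| + 1`, hence exceeds `C`; the radius
  -- needs `ε > 0`.
  set R := √(b * (|C| + 1) / (c * ε)) with hR
  have hR0 : 0 < R := Real.sqrt_pos.2 (by positivity)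
  obtain ⟨x, hx⟩ := exists_zero_of_continuous hGc hR0 fun x hx => by
    rw [hinner]
    refine lt_of_lt_of_le ?_ (hen ε η hε.le hη (P x))
    have h1 := hnorm x
    rw [hx, hR, Real.sq_sqrt (by positivity), div_le_iff₀ (by positivity)] at h1
    have h2 : |C| + 1 ≤ c * (ε * ∑ α, M.gradNorm (P x α).1 ^ 2) := by
      refine le_of_mul_le_mul_left ?_ hb0
      linarith
    have h3 : 0 ≤ c * (M.gradNorm (zeta D (P x) 1) ^ 2) := by positivity
    have h4 : 0 ≤ c * (η * M.gradNorm (P x 0 - P x 1 : M.dirichletSpace ΓD).1 ^ 2) := by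
      positivity
    linarith [le_abs_self C]
  refine ⟨P x, funext fun α => funext fun K => ?_⟩
  exact congrArg (fun y : EuclideanSpace ℝ (Fin 2 × M.FreeVertex ΓD) => y (α, K)) hx

/-- The pressures are controlled by the global pressure and the capillary pressure. -/
theorem norm_pressures_le (p : M.Pressures ΓD) {a b : ℝ} (ha : ∀ K, |zeta D p 1 K| ≤ a)
    (hb : ∀ K, |(p 0).1 K - (p 1).1 K| ≤ b) (ha0 : 0 ≤ a) (hb0 : 0 ≤ b) : ‖p‖ ≤ a + 2 * b := by
  have h1 : ∀ K, |(p 1).1 K| ≤ a + b := by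
    intro K
    have h := D.abs_pHatW_le (sat D p 0 K)
    rw [pc_sat] at h
    have hz := zeta_one D p K
    have ha' := abs_le.1 (ha K)
    have hb' := abs_le.1 (h.trans (hb K))
    exact abs_le.2 ⟨by linarith, by linarith⟩
  refine (pi_norm_le_iff_of_nonneg (by positivity)).2 fun α => ?_
  rw [Submodule.coe_norm]
  refine (pi_norm_le_iff_of_nonneg (by positivity)).2 fun K => ?_
  rw [Real.norm_eq_abs]
  have h2 := abs_le.1 (h1 K)
  have h3 := abs_le.1 (hb K)
  fin_cases α
  · exact abs_le.2 ⟨by simp only [Fin.zero_eta]; linarith, by simp only [Fin.zero_eta]; linarith⟩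
  · exact (h1 K).trans (by linarith)

/-- Solutions for `ε = 0`. -/
theorem exists_schemeReg_zero_eq_zero (hΩc : IsConnected Ω) (hΩ : volume (frontier Ω) = 0)
    (hM : ∃ K, M.pos K ∈ ΓD) {δt : ℝ} (hδt : 0 < δt) (pn : M.Pressures ΓD)
    (hpn : ∀ α K, 0 ≤ sat D pn α K ∧ sat D pn α K ≤ 1) {η : ℝ} (hη : 0 < η) :
    ∃ p : M.Pressures ΓD, schemeReg D δt pn 0 η p = 0 := by
  obtain ⟨C, hC⟩ := exists_energy_bound D hΩ hδt pn hpn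
  obtain ⟨a, ha, hpoin⟩ := M.exists_abs_le_gradNorm hΩc hM
  obtain ⟨p, -, hp⟩ := exists_zero_of_forall_pos (F := fun ε p => schemeReg D δt pn ε η p)
    ((continuous_schemeReg D δt pn).comp (by fun_prop :
      Continuous fun q : ℝ × M.Pressures ΓD => (q.1, η, q.2)))
    -- The Poincaré inequality bounds the global pressure by `a * √C` and `p_g - p_w` by `a * √(C /
    -- η)`, uniformly in `ε` but not in `η`.
    (isCompact_closedBall (0 : M.Pressures ΓD) (a * √C + 2 * (a * √(C / η)))) 0 fun ε hε => by
      obtain ⟨p, hp⟩ := exists_schemeReg_eq_zero D hΩc hΩ hM hδt pn hpn hε hη.le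
      refine ⟨p, ?_, hp⟩
      have h := hC ε η hε.le hη.le p hp
      have hA : 0 ≤ M.gradNorm (zeta D p 1) ^ 2 := sq_nonneg _
      have hB : 0 ≤ ε * ∑ α, M.gradNorm (p α).1 ^ 2 :=
        mul_nonneg hε.le (Finset.sum_nonneg fun α _ => sq_nonneg _)
      have hE : 0 ≤ η * M.gradNorm (p 0 - p 1 : M.dirichletSpace ΓD).1 ^ 2 :=
        mul_nonneg hη.le (sq_nonneg _)
      rw [mem_closedBall_zero_iff]
      refine norm_pressures_le D p (fun K => ?_) (fun K => ?_) (by positivity) (by positivity)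
      · refine (hpoin _ (zeta_mem D p) K).trans (mul_le_mul_of_nonneg_left ?_ ha.le)
        exact Real.le_sqrt_of_sq_le (by linarith)
      · refine (hpoin _ (p 0 - p 1 : M.dirichletSpace ΓD).2 K).trans
          (mul_le_mul_of_nonneg_left ?_ ha.le)
        refine Real.le_sqrt_of_sq_le ?_
        rw [le_div_iff₀ hη]
        linarith
  exact ⟨p, hp⟩

/-- Existence of a solution of the original scheme with saturations in the physical range. -/
theorem exists_scheme_eq_zero (hΩc : IsConnected Ω) (hΩ : volume (frontier Ω) = 0)
    (hM : ∃ K, M.pos K ∈ ΓD) {δt : ℝ} (hδt : 0 < δt) (pn : M.Pressures ΓD)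
    (hpn : ∀ α K, 0 ≤ sat D pn α K ∧ sat D pn α K ≤ 1) :
    ∃ p : M.Pressures ΓD, scheme D δt pn p = 0 ∧
      ∀ α K, 0 ≤ sat D p α K ∧ sat D p α K ≤ 1 := by
  obtain ⟨C, hC⟩ := exists_energy_bound D hΩ hδt pn hpn
  obtain ⟨a, ha, hpoin⟩ := M.exists_abs_le_gradNorm hΩc hM
  have hclosed : IsClosed {p : M.Pressures ΓD | ∀ α K, 0 ≤ sat D p α K ∧ sat D p α K ≤ 1} := by
    simp only [ofPred_forall]
    exact isClosed_iInter fun α => isClosed_iInter fun K =>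
      (isClosed_le continuous_const (continuous_sat D α K)).inter
        (isClosed_le (continuous_sat D α K) continuous_const)
  have hpc1 : 0 ≤ D.pc 1 := D.pc_zero ▸ D.pc_strictMono.monotone zero_le_one
  obtain ⟨p, hpS, hp⟩ := exists_zero_of_forall_pos (F := fun η p => schemeReg D δt pn 0 η p)
    ((continuous_schemeReg D δt pn).comp (by fun_prop :
      Continuous fun q : ℝ × M.Pressures ΓD => ((0 : ℝ), q.1, q.2)))
    -- The maximum principle replaces the `η`-dependent bound by `0 ≤ pc(s_g) ≤ pc 1`; intersecting
    -- with a closed set passes the saturation bounds to the limit.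
    ((isCompact_closedBall (0 : M.Pressures ΓD) (a * √C + 2 * D.pc 1)).inter_right hclosed) 0
    fun η hη => by
      obtain ⟨p, hp⟩ := exists_schemeReg_zero_eq_zero D hΩc hΩ hM hδt pn hpn hη
      have hs := sat_mem_of_schemeReg_eq_zero D hΩc hΩ hM hδt hpn hη hp
      refine ⟨p, ⟨?_, hs⟩, hp⟩
      have h := hC 0 η le_rfl hη.le p hp
      have hE : 0 ≤ η * M.gradNorm (p 0 - p 1 : M.dirichletSpace ΓD).1 ^ 2 :=
        mul_nonneg hη.le (sq_nonneg _)
      rw [mem_closedBall_zero_iff]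
      refine norm_pressures_le D p (fun K => ?_) (fun K => ?_) (by positivity) hpc1
      · refine (hpoin _ (zeta_mem D p) K).trans (mul_le_mul_of_nonneg_left ?_ ha.le)
        exact Real.le_sqrt_of_sq_le (by linarith)
      · rw [← pc_sat D]
        have h0 := D.pc_strictMono.monotone (hs 0 K).1
        have h1 := D.pc_strictMono.monotone (hs 0 K).2
        rw [D.pc_zero] at h0
        rwa [abs_of_nonneg h0]
  exact ⟨p, by rw [← schemeReg_zero]; exact hp, hpS.2⟩

end Existence
end CVFE

theorem mainTheorem3 {V : Type*} [Fintype V] [DecidableEq V]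
    (Ω : Set CVFE.Plane) (hΩ_open : IsOpen Ω) (hΩ_conn : IsConnected Ω)
    (hΩ_bdry : MeasureTheory.volume (frontier Ω) = 0)
    (ΓD : Set CVFE.Plane) (hΓD : ΓD ⊆ frontier Ω)
    (M : CVFE.TriMesh V Ω) (hM : ∃ K, M.pos K ∈ ΓD)
    (D : CVFE.TwoPhaseModel Ω) (δt : ℝ) (hδt : 0 < δt)
    (pn : M.Pressures ΓD)
    (hpn : ∀ α K, 0 ≤ CVFE.sat D pn α K ∧ CVFE.sat D pn α K ≤ 1)
    (σ₁ σ₂ : Equiv.Perm (Fin 2)) (hσ : ∀ i, σ₁ i ≠ σ₂ i) :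
    CVFE.IsRegularizedScheme (M.dirichletSpace ΓD) M.gradNorm (CVFE.sat D) (CVFE.zeta D) 0 1
      σ₁ σ₂ (CVFE.scheme D δt pn) (CVFE.schemeReg D δt pn) ∧
    (∀ ε > 0, ∀ η > 0, ∃ p : M.Pressures ΓD, CVFE.schemeReg D δt pn ε η p = 0) ∧
    ∃ p : M.Pressures ΓD, CVFE.scheme D δt pn p = 0 ∧
      ∀ α K, 0 ≤ CVFE.sat D p α K ∧ CVFE.sat D p α K ≤ 1 := by
  exact ⟨CVFE.isRegularizedScheme D hΩ_conn hΩ_bdry hM hδt pn hpn hσ,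
    fun ε hε η hη => CVFE.exists_schemeReg_eq_zero D hΩ_conn hΩ_bdry hM hδt pn hpn hε hη.le,
    CVFE.exists_scheme_eq_zero D hΩ_conn hΩ_bdry hM hδt pn hpn⟩
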